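/- **Setting.** Let $N_T,N_R\ge 1$ be the numbers of transmit and receive antennas. Let $s_1,\dots,s_{N_T}:\mathbb R\to\mathbb C$ be random signals that are periodic with period $T$, let $B>0$ be the bandwidth, $\Delta_t=\frac1{2B}$ and $N_t=T/\Delta_t\in\mathbb N$, and suppose that the samples $s_i(l\Delta_t)$, $1\le i\le N_T$, $1\le l\le N_t$, are independent circularly symmetric complex Gaussian variables with law $\mathcal{CN}(0,1/N_T)$. Put $\mathbf a_T(\beta)=(e^{2\pi j d_T\beta k})_{k=0}^{N_T-1}$ and $\mathbf a_R(\beta)=(e^{2\pi j d_R\beta k})_{k=0}^{N_R-1}$, where either $d_T=\frac12,\ d_R=\frac{N_T}2$ or $d_T=\frac{N_R}2,\ d_R=\frac12$. Let $\mathbf S_\tau$ be the $N_t\times N_T$ matrix with entries $s_i(l\Delta_t-\tau)$. Let $\Delta_\beta=\frac{2}{N_RN_T}$, $N_\beta=N_RN_T$, $\Delta_\tau=\frac1{2B}$, and let $\mathbf A$ be the $N_RN_t\times N_\tau N_\beta$ matrix whose columns are $\mathbf A_{\tau,\beta}=\operatorname{vec}\big(\mathbf a_R(\beta)\,\mathbf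 a_T(\beta)^T\,\mathbf S_\tau^T\big)$ for $\tau=m\Delta_\tau$, $1\le m\le N_\tau$, and $\beta=n\Delta_\beta$, $1\le n\le N_\beta$. Let $\mathbf D$ be the diagonal matrix with entries $\|\mathbf A_{\tau,\beta}\|_2$ and let $\tilde{\mathbf A}=\mathbf A\mathbf D^{-1}$ (which is defined almost surely). For a matrix $\mathbf M$ with columns $\mathbf M_k$, $\|\mathbf M\|_{\rm op}$ is its largest singular value and $\mu(\mathbf M)=\max_{k\ne l}\frac{|\langle \mathbf M_k,\mathbf M_l\rangle|}{\|\mathbf M_k\|_2\|\mathbf M_l\|_2}$ its coherence ($0$ if there is only one column). **Lemma.** There is a numerical constant $C>0$, independent of all parameters, such that whenever $$N_t\ge 128,\qquad \sqrt{N_\beta}\le N_\tau\le N_t,\qquad \big(\log(N_\tau N_\beta)\big)^3\le N_t,$$ one has $$\mathbb P\Big(\|\tilde{\mathbf A}\|_{\rm op}^2<3N_T(1+\log N_t)\Big)\ge 1-p_1,\qquad p_1=e^{-N_t\frac{(\sqrt{1/3}-1)^2}{2}}+N_t^{\,1-C\sqrt{N_T}},$$ and $$\mathbb P\Big(\mu(\tilde{\mathbf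 A})\le 6\sqrt{\tfrac1{N_t}\log(N_\tau N_RN_T)}\Big)\ge 1-p_2,\qquad p_2=2e^{-\frac{N_t(\sqrt2-1)^2}{4}}+2(N_RN_T)^{-1}+6(N_tN_RN_T)^{-1}.$$ -/

import Mathlib

open MeasureTheory ProbabilityTheory
open scoped NNReal

noncomputable section

namespace MIMORadar

/-- The circularly symmetric complex Gaussian law `CN(0, v)`: real and imaginary part are
independent real Gaussians of mean `0` and variance `v / 2`. -/
def complexGaussian (v : ℝ≥0) : Measure ℂ :=
  ((gaussianReal 0 (v / 2)).prod (gaussianReal 0 (v / 2))).map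
    Complex.measurableEquivRealProd.symm

/-- Random waveforms `s i : ℝ → ℂ` (the sample point is the last argument) which are periodic
with period `T` and whose samples at the times `Δt, 2 Δt, …, Nt Δt` are jointly independent
(over the waveforms and over the sampling times) with law `CN(0, v)`. -/
structure IsPeriodicWhiteNoise {Ω : Type*} [MeasurableSpace Ω] (P : Measure Ω)
    {NT : ℕ} (Nt : ℕ) (T Δt : ℝ) (v : ℝ≥0) (s : Fin NT → ℝ → Ω → ℂ) : Prop where
  periodic : ∀ i ω, Function.Periodic (fun t => s i t ω) T
  law : ∀ (i : Fin NT) (l : Fin Nt),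
    HasLaw (fun ω => s i (((l : ℝ) + 1) * Δt) ω) (complexGaussian v) P
  indep : iIndepFun
    (fun (p : Fin NT × Fin Nt) (ω : Ω) => s p.1 (((p.2 : ℝ) + 1) * Δt) ω) P

/-- The array manifold of a uniformly spaced linear array with `N` elements and normalized
spacing `d`: its `k`-th entry is `exp (2 π j d β k)`, `k = 0, …, N - 1`. -/
def arrayManifold (N : ℕ) (d β : ℝ) : Fin N → ℂ :=
  fun k => Complex.exp (2 * Real.pi * Complex.I * (d * β * (k : ℝ) : ℝ))

/-- The `Nt × NT` matrix `S_τ` whose columns are the delayed signals `s i (t - τ)` sampled at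
`t = Δt, 2 Δt, …, Nt Δt`. For a signal of period `Nt Δt` the delay is circular. -/
def delayedSignals {NT : ℕ} (Nt : ℕ) (Δt : ℝ) (s : Fin NT → ℝ → ℂ) (τ : ℝ) :
    Matrix (Fin Nt) (Fin NT) ℂ :=
  Matrix.of fun l i => s i (((l : ℝ) + 1) * Δt - τ)

/-- The noise-free received signal matrix `Z(β, τ) = a_R(β) a_T(β)ᵀ S_τᵀ` of a unit strength
target at direction `β` and delay `τ`. -/
def receivedSignal {NT : ℕ} (NR Nt : ℕ) (dT dR Δt : ℝ) (s : Fin NT → ℝ → ℂ) (β τ : ℝ) :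
    Matrix (Fin NR) (Fin Nt) ℂ :=
  Matrix.vecMulVec (arrayManifold NR dR β) (arrayManifold NT dT β) *
    (delayedSignals Nt Δt s τ).transpose

/-- The response matrix: its column with index `(m, n)` is the vectorized received signal
`vec Z(β, τ)` for the delay `τ = (m + 1) Δτ` and the direction `β = (n + 1) Δβ`. -/
def responseMatrix {NT : ℕ} (NR Nt Nτ Nβ : ℕ) (dT dR Δt Δτ Δβ : ℝ) (s : Fin NT → ℝ → ℂ) :
    Matrix (Fin NR × Fin Nt) (Fin Nτ × Fin Nβ) ℂ :=
  Matrix.of fun r c =>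
    receivedSignal NR Nt dT dR Δt s (((c.2 : ℝ) + 1) * Δβ) (((c.1 : ℝ) + 1) * Δτ) r.1 r.2

/-- The `k`-th column of a matrix, as a vector of the Euclidean space. -/
def column {m n : Type*} (M : Matrix m n ℂ) (k : n) : EuclideanSpace ℂ m :=
  WithLp.toLp 2 (fun i => M i k)

/-- The diagonal matrix of the Euclidean norms of the columns. -/
def columnNormMatrix {m n : Type*} [Fintype m] [DecidableEq n] (M : Matrix m n ℂ) :
    Matrix n n ℂ :=
  Matrix.diagonal fun k => ((‖column M k‖ : ℝ) : ℂ)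

/-- The column-normalized matrix `M D⁻¹`, with `D` the diagonal matrix of the column norms. -/
def normalizeColumns {m n : Type*} [Fintype m] [Fintype n] [DecidableEq n]
    (M : Matrix m n ℂ) : Matrix m n ℂ :=
  M * (columnNormMatrix M)⁻¹

open scoped Matrix.Norms.L2Operator in
/-- The operator norm (largest singular value) of a complex matrix. -/
def opNorm {m n : Type*} [Fintype m] [Fintype n] [DecidableEq n] (M : Matrix m n ℂ) : ℝ :=
  ‖M‖

/-- The coherence: the maximum over `k ≠ l` of `|⟨M_k, M_l⟩| / (‖M_k‖ ‖M_l‖)`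
(and `0` if there are no two distinct columns). -/
def coherence {m n : Type*} [Fintype m] (M : Matrix m n ℂ) : ℝ :=
  ⨆ p : {p : n × n // p.1 ≠ p.2},
    ‖inner ℂ (column M p.1.1) (column M p.1.2)‖ /
      (‖column M p.1.1‖ * ‖column M p.1.2‖)

end MIMORadar

end

noncomputable section

namespace MIMORadar

open scoped ZMod ComplexConjugate

/-! A delay acts on one period of samples as a translation of the cyclic group of order `Nt`, and
the discrete Fourier transform turns it into multiplication by a character. The transform maps white
noise to white noise: for a direction `b`, the coefficients `X_b(f)` of the transmitted beam are
independent with law `CN(0,1)` (`hasLaw_unitaryDFT`). On the grid of directions, the products of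
receive and transmit phases are the characters of a cyclic group of order `NR * NT`
(`arrayManifold_mul_arrayManifold`).

Operator norm: Parseval over the directions and over a full cycle of delays bounds `‖A* u‖²` by `NR
NT Nt G ‖u‖²`, where `G` is the largest energy over all antennas at one frequency
(`sum_norm_sq_inner_column_le`). The squared column norms are `NR ∑ |X_b(f)|²`. Chernoff bounds give
`G < 1 + log Nt` and squared norms above `NR Nt / 3`; the quotient is the claim.

Coherence: the inner product of two columns is the receive inner product times a character-weighted
correlation of `X_b` and `X_b'` (`inner_column_column`). For one direction and distinct delays the
weights sum to zero, which leaves a centred quadratic form. For distinct directions the virtual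
vectors are orthogonal, so the receive or the transmit vectors are orthogonal. In the first case the
inner product vanishes; in the second `X_b` and `X_b'` are independent, and polarization gives a
centred difference of squares. Both tails come from `measureReal_le_sum_normSq_of_sum_eq_zero`,
followed by a union bound. -/

instance isProbabilityMeasure_complexGaussian (v : ℝ≥0) :
    IsProbabilityMeasure (complexGaussian v) :=
  Measure.isProbabilityMeasure_map Complex.measurableEquivRealProd.symm.measurable.aemeasurable

/-! ### Complex Gaussian vectors and their unitary invariance -/

lemma integral_complexGaussian {E : Type*} [NormedAddCommGroup E] [NormedSpace ℝ E] (v : ℝ≥0)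
    (f : ℂ → E) :
    ∫ z, f z ∂(complexGaussian v) = ∫ p : ℝ × ℝ, f ⟨p.1, p.2⟩
      ∂((gaussianReal 0 (v / 2)).prod (gaussianReal 0 (v / 2))) := by
  rw [complexGaussian, integral_map_equiv]
  rfl

lemma charFun_complexGaussian (v : ℝ≥0) (t : ℂ) :
    charFun (complexGaussian v) t = Complex.exp (-((v : ℝ) * ‖t‖ ^ 2 / 4 : ℝ)) := by
  rw [charFun_apply, integral_complexGaussian]
  have h : ∀ p : ℝ × ℝ, Complex.exp ((inner ℝ (⟨p.1, p.2⟩ : ℂ) t : ℝ) * Complex.I)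
      = Complex.exp ((inner ℝ p.1 t.re : ℝ) * Complex.I)
        * Complex.exp ((inner ℝ p.2 t.im : ℝ) * Complex.I) := by
    intro p
    rw [← Complex.exp_add]
    congr 1
    simp [Complex.inner, RCLike.inner_apply]
    ring
  simp_rw [h]
  rw [integral_prod_mul (fun x : ℝ => Complex.exp ((inner ℝ x t.re : ℝ) * Complex.I))
    (fun x : ℝ => Complex.exp ((inner ℝ x t.im : ℝ) * Complex.I)), ← charFun_apply,
    ← charFun_apply, charFun_gaussianReal, charFun_gaussianReal, ← Complex.exp_add]
  congr 1
  rw [Complex.sq_norm, Complex.normSq_apply]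
  push_cast
  ring

lemma inner_mulVec_eq {ι κ : Type*} [Fintype ι] [Fintype κ] (U : Matrix κ ι ℂ) (x : ι → ℂ)
    (t : EuclideanSpace ℂ κ) :
    (inner ℝ (WithLp.toLp 2 (U.mulVec x) : PiLp 2 fun _ : κ => ℂ) t : ℝ)
      = inner ℝ (WithLp.toLp 2 x : PiLp 2 fun _ : ι => ℂ)
        (WithLp.toLp 2 (U.conjTranspose.mulVec t.ofLp)) := by
  simp only [PiLp.inner_apply, Complex.inner, Matrix.mulVec, dotProduct, Matrix.conjTranspose_apply,
    map_sum, map_mul, Finset.sum_mul, Finset.mul_sum, Complex.re_sum]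
  rw [Finset.sum_comm]
  refine Finset.sum_congr rfl fun i _ => Finset.sum_congr rfl fun k _ => ?_
  congr 1
  simp only [RCLike.star_def]
  ring

lemma star_dotProduct_self_eq {ι : Type*} [Fintype ι] (w : ι → ℂ) :
    star w ⬝ᵥ w = ((∑ i, ‖w i‖ ^ 2 : ℝ) : ℂ) := by
  simp [dotProduct, Complex.conj_mul']

lemma sum_normSq_conjTranspose_mulVec {ι κ : Type*} [Fintype ι] [Fintype κ] [DecidableEq κ]
    {U : Matrix κ ι ℂ} {c : ℝ≥0} (hU : U * U.conjTranspose = ((c : ℝ) : ℂ) • 1) (t : κ → ℂ) :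
    ∑ i, ‖U.conjTranspose.mulVec t i‖ ^ 2 = c * ∑ k, ‖t k‖ ^ 2 := by
  have key : star (U.conjTranspose.mulVec t) ⬝ᵥ (U.conjTranspose.mulVec t)
      = ((c : ℝ) : ℂ) * (star t ⬝ᵥ t) := by
    rw [Matrix.star_mulVec, Matrix.conjTranspose_conjTranspose, Matrix.dotProduct_mulVec,
      Matrix.vecMul_vecMul, hU, Matrix.vecMul_smul, Matrix.vecMul_one, smul_dotProduct, smul_eq_mul]
  rw [star_dotProduct_self_eq, star_dotProduct_self_eq] at key
  exact_mod_cast key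

/-- The characteristic function of the product law depends on its argument only through the
Euclidean norm, and `Uᴴ` scales squared norms by `c`. The matrix may be rectangular, which covers
selecting coordinates as well as rotating them. -/
lemma pi_complexGaussian_map_mulVec {ι κ : Type*} [Fintype ι] [Fintype κ] [DecidableEq κ]
    {U : Matrix κ ι ℂ} {c : ℝ≥0} (hU : U * U.conjTranspose = ((c : ℝ) : ℂ) • 1) (v : ℝ≥0) :
    (Measure.pi fun _ : ι => complexGaussian v).map U.mulVec
      = Measure.pi fun _ : κ => complexGaussian (c * v) := by
  have hm : Measurable (fun x : ι → ℂ => U.mulVec x) := by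
    unfold Matrix.mulVec dotProduct
    fun_prop
  have : IsProbabilityMeasure ((Measure.pi fun _ : ι => complexGaussian v).map U.mulVec) :=
    Measure.isProbabilityMeasure_map hm.aemeasurable
  refine charFun_eq_pi_iff.1 fun t => ?_
  have h1 : charFun (((Measure.pi fun _ : ι => complexGaussian v).map U.mulVec).map
      (WithLp.toLp 2)) t = charFun ((Measure.pi fun _ : ι => complexGaussian v).map
        (WithLp.toLp 2)) (WithLp.toLp 2 (U.conjTranspose.mulVec t.ofLp)) := by
    rw [charFun_apply, charFun_apply, ← MeasurableEquiv.coe_toLp, ← MeasurableEquiv.coe_toLp,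
      integral_map_equiv, integral_map_equiv, integral_map hm.aemeasurable]
    · refine integral_congr_ae (Filter.Eventually.of_forall fun x => ?_)
      simp only [MeasurableEquiv.coe_toLp]
      rw [← inner_mulVec_eq]
    · refine Measurable.aestronglyMeasurable ?_
      simp only [MeasurableEquiv.coe_toLp]
      fun_prop
  rw [h1, charFun_pi]
  simp_rw [charFun_complexGaussian]
  rw [← Complex.exp_sum, ← Complex.exp_sum]
  congr 1
  have := sum_normSq_conjTranspose_mulVec hU t.ofLp
  rw [Finset.sum_neg_distrib, Finset.sum_neg_distrib]
  congr 1
  rw [← Complex.ofReal_sum, ← Complex.ofReal_sum, ← Finset.sum_div, ← Finset.sum_div,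
    ← Finset.mul_sum, ← Finset.mul_sum, this]
  push_cast
  ring_nf

lemma hasLaw_mulVec {Ω ι κ : Type*} [MeasurableSpace Ω] {P : Measure Ω} [Fintype ι] [Fintype κ]
    [DecidableEq κ] {U : Matrix κ ι ℂ} {c : ℝ≥0}
    (hU : U * U.conjTranspose = ((c : ℝ) : ℂ) • 1) {v : ℝ≥0} {X : Ω → ι → ℂ}
    (hX : HasLaw X (Measure.pi fun _ => complexGaussian v) P) :
    HasLaw (fun ω => U.mulVec (X ω)) (Measure.pi fun _ => complexGaussian (c * v)) P := by
  have hm : Measurable (fun x : ι → ℂ => U.mulVec x) := by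
    unfold Matrix.mulVec dotProduct
    fun_prop
  exact HasLaw.fun_comp (Y := U.mulVec) ⟨hm.aemeasurable, pi_complexGaussian_map_mulVec hU v⟩ hX

/-! ### Chernoff bounds for diagonal quadratic forms -/

lemma integral_exp_mul_sq_gaussianReal (s : ℝ) :
    ∫ x, Real.exp (s * x ^ 2) ∂(gaussianReal 0 (1 / 2)) = Real.sqrt (1 - s)⁻¹ := by
  rw [integral_gaussianReal_eq_integral_smul (by norm_num)]
  have h : ∀ x : ℝ, gaussianPDFReal 0 (1 / 2) x • Real.exp (s * x ^ 2)
      = (Real.sqrt Real.pi)⁻¹ * Real.exp (-(1 - s) * x ^ 2) := by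
    intro x
    rw [gaussianPDFReal, smul_eq_mul, mul_assoc, ← Real.exp_add]
    push_cast
    congr 3
    · ring
    · ring
  simp_rw [h]
  rw [integral_const_mul, integral_gaussian, Real.sqrt_div Real.pi_pos.le, Real.sqrt_inv]
  field_simp

lemma integral_exp_mul_normSq_complexGaussian {s : ℝ} (hs : s < 1) :
    ∫ z, Real.exp (s * ‖z‖ ^ 2) ∂(complexGaussian 1) = (1 - s)⁻¹ := by
  rw [integral_complexGaussian]
  have h : ∀ p : ℝ × ℝ, Real.exp (s * ‖(⟨p.1, p.2⟩ : ℂ)‖ ^ 2)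
      = Real.exp (s * p.1 ^ 2) * Real.exp (s * p.2 ^ 2) := by
    intro p
    rw [← Real.exp_add, Complex.sq_norm, Complex.normSq_apply]
    ring_nf
  simp_rw [h]
  rw [integral_prod_mul (fun x : ℝ => Real.exp (s * x ^ 2)) (fun x : ℝ => Real.exp (s * x ^ 2)),
    integral_exp_mul_sq_gaussianReal, Real.mul_self_sqrt]
  exact inv_nonneg.2 (by linarith)

lemma integral_exp_sum_normSq {κ : Type*} [Fintype κ] {l : κ → ℝ} (hl : ∀ k, l k < 1) :
    ∫ z, Real.exp (∑ k, l k * ‖z k‖ ^ 2) ∂(Measure.pi fun _ : κ => complexGaussian 1)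
      = ∏ k, (1 - l k)⁻¹ := by
  simp_rw [Real.exp_sum]
  rw [integral_fintype_prod_eq_prod (fun k z => Real.exp (l k * ‖z‖ ^ 2))]
  exact Finset.prod_congr rfl fun k _ => integral_exp_mul_normSq_complexGaussian (hl k)

/-- Chernoff's bound for a diagonal quadratic form in independent standard complex Gaussians. -/
lemma measureReal_le_sum_normSq {Ω κ : Type*} [MeasurableSpace Ω] {P : Measure Ω}
    [IsProbabilityMeasure P] [Fintype κ] {X : Ω → κ → ℂ}
    (hX : HasLaw X (Measure.pi fun _ => complexGaussian 1) P) {l : κ → ℝ} (hl : ∀ k, l k < 1)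
    (r : ℝ) :
    P.real {ω | r ≤ ∑ k, l k * ‖X ω k‖ ^ 2} ≤ Real.exp (-r) * ∏ k, (1 - l k)⁻¹ := by
  set Q := Measure.pi fun _ : κ => complexGaussian 1
  have hm : Measurable fun z : κ → ℂ => ∑ k, l k * ‖z k‖ ^ 2 := by fun_prop
  have h1 : P.real {ω | r ≤ ∑ k, l k * ‖X ω k‖ ^ 2}
      = Q.real {z | r ≤ ∑ k, l k * ‖z k‖ ^ 2} :=
    hX.measureReal_eq (p := fun z => r ≤ ∑ k, l k * ‖z k‖ ^ 2) (measurableSet_le measurable_const hm)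
  have hpos : 0 < ∏ k, (1 - l k)⁻¹ :=
    Finset.prod_pos fun k _ => inv_pos.2 (by linarith [hl k])
  have hint := integral_exp_sum_normSq hl
  have h2 := measure_ge_le_exp_mul_mgf (μ := Q) (X := fun z : κ → ℂ => ∑ k, l k * ‖z k‖ ^ 2)
    (t := 1) r zero_le_one (by
      simp only [one_mul]
      -- Integrability is free: a non-integrable function would have Bochner integral `0`, but the
      -- product is positive.
      by_contra hc
      rw [integral_undef hc] at hint
      exact hpos.ne hint)
  rw [h1]
  refine h2.trans (le_of_eq ?_)
  simp only [mgf, one_mul, neg_mul]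
  rw [hint]

lemma measureReal_sum_normSq_le {Ω κ : Type*} [MeasurableSpace Ω] {P : Measure Ω}
    [IsProbabilityMeasure P] [Fintype κ] {X : Ω → κ → ℂ}
    (hX : HasLaw X (Measure.pi fun _ => complexGaussian 1) P) {s : ℝ} (hs : 0 < s) (a : ℝ) :
    P.real {ω | ∑ k, ‖X ω k‖ ^ 2 ≤ a * Fintype.card κ}
      ≤ (Real.exp (s * a) * (1 + s)⁻¹) ^ Fintype.card κ := by
  have h := measureReal_le_sum_normSq hX (l := fun _ => -s) (fun _ => by linarith)
    (-(s * (a * Fintype.card κ)))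
  have h1 : {ω | ∑ k, ‖X ω k‖ ^ 2 ≤ a * Fintype.card κ}
      = {ω | -(s * (a * Fintype.card κ)) ≤ ∑ k, -s * ‖X ω k‖ ^ 2} := by
    ext ω
    simp only [Set.mem_ofPred_eq]
    rw [← Finset.mul_sum, neg_mul, neg_le_neg_iff, mul_le_mul_iff_of_pos_left hs]
  rw [h1]
  refine h.trans (le_of_eq ?_)
  rw [Finset.prod_const, Finset.card_univ, mul_pow, ← Real.exp_nat_mul]
  ring_nf

lemma measureReal_le_sum_normSq_const {Ω κ : Type*} [MeasurableSpace Ω] {P : Measure Ω}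
    [IsProbabilityMeasure P] [Fintype κ] {X : Ω → κ → ℂ}
    (hX : HasLaw X (Measure.pi fun _ => complexGaussian 1) P) {x : ℝ} (hx : 0 < x) :
    P.real {ω | Fintype.card κ * (1 + x) ≤ ∑ k, ‖X ω k‖ ^ 2}
      ≤ (Real.exp (-x) * (1 + x)) ^ Fintype.card κ := by
  have hs : 0 < x / (1 + x) := by positivity
  have hs1 : 1 - x / (1 + x) = (1 + x)⁻¹ := by field_simp; ring
  have h := measureReal_le_sum_normSq hX (l := fun _ => x / (1 + x))
    (fun _ => by rw [← sub_pos, hs1]; positivity) (x / (1 + x) * (Fintype.card κ * (1 + x)))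
  have h1 : {ω | Fintype.card κ * (1 + x) ≤ ∑ k, ‖X ω k‖ ^ 2}
      = {ω | x / (1 + x) * (Fintype.card κ * (1 + x)) ≤ ∑ k, x / (1 + x) * ‖X ω k‖ ^ 2} := by
    ext ω
    simp only [Set.mem_ofPred_eq, ← Finset.mul_sum]
    exact (mul_le_mul_iff_of_pos_left hs).symm
  rw [h1]
  refine h.trans (le_of_eq ?_)
  rw [Finset.prod_const, Finset.card_univ, mul_pow, ← Real.exp_nat_mul, hs1, inv_inv]
  congr 2
  field_simp

/-- In the expansion of `-log (1 - x)` the remainder after `x + x²/2` is at most `|x|³ / (1 - |x|)`,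
which is at most `x²/2` exactly when `|x| ≤ 1/3`. -/
lemma inv_one_sub_le_exp {x : ℝ} (hx : |x| ≤ 1 / 3) : (1 - x)⁻¹ ≤ Real.exp (x + x ^ 2) := by
  have h1 : 0 < 1 - x := by linarith [le_abs_self x]
  have h := Real.abs_log_sub_add_sum_range_le (x := x) (by linarith) 2
  simp only [Finset.sum_range_succ, Finset.sum_range_zero] at h
  norm_num at h
  have h3 : |x| ^ 3 / (1 - |x|) ≤ x ^ 2 / 2 := by
    rw [div_le_iff₀ (by linarith), ← sq_abs]
    nlinarith [sq_nonneg |x|, abs_nonneg x]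
  have h4 := (abs_le.1 (h.trans h3)).1
  rw [← Real.log_le_iff_le_exp (by positivity), Real.log_inv]
  linarith

/-- The linear terms of the log-moment generating function cancel because the weights sum to zero,
so only the quadratic terms remain. -/
lemma measureReal_le_sum_normSq_of_sum_eq_zero {Ω κ : Type*} [MeasurableSpace Ω] {P : Measure Ω}
    [IsProbabilityMeasure P] [Fintype κ] {X : Ω → κ → ℂ}
    (hX : HasLaw X (Measure.pi fun _ => complexGaussian 1) P) {l : κ → ℝ}
    (hl : ∀ k, |l k| ≤ 1 / 3) (h0 : ∑ k, l k = 0) (r : ℝ) :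
    P.real {ω | r ≤ ∑ k, l k * ‖X ω k‖ ^ 2} ≤ Real.exp (-r + ∑ k, l k ^ 2) := by
  refine (measureReal_le_sum_normSq hX
    (fun k => (le_abs_self _).trans_lt ((hl k).trans_lt (by norm_num))) r).trans ?_
  rw [Real.exp_add]
  refine mul_le_mul_of_nonneg_left ?_ (Real.exp_pos _).le
  have : ∑ k, l k ^ 2 = ∑ k, (l k + l k ^ 2) := by rw [Finset.sum_add_distrib, h0, zero_add]
  rw [this, Real.exp_sum]
  refine Finset.prod_le_prod (fun k _ => ?_) fun k _ => inv_one_sub_le_exp (hl k)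
  have := (le_abs_self _).trans (hl k)
  exact inv_nonneg.2 (by linarith)

/-- The quadratic form of a unimodular, zero-sum multiplier. -/
lemma measureReal_le_sum_re_mul_normSq {Ω κ : Type*} [MeasurableSpace Ω] {P : Measure Ω}
    [IsProbabilityMeasure P] [Fintype κ] {X : Ω → κ → ℂ}
    (hX : HasLaw X (Measure.pi fun _ => complexGaussian 1) P) {c : κ → ℂ}
    (hc : ∀ k, ‖c k‖ ≤ 1) (h0 : ∑ k, c k = 0) {a : ℝ} (ha : 0 < a) (ha' : a ≤ 2 / 3) :
    P.real {ω | a * Fintype.card κ ≤ (∑ k, c k * (‖X ω k‖ ^ 2 : ℝ)).re}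
      ≤ Real.exp (-(a ^ 2 / 4 * Fintype.card κ)) := by
  have hre : ∀ k, |(c k).re| ≤ 1 := fun k => (Complex.abs_re_le_norm _).trans (hc k)
  -- The factor `a / 2` maximizes `λ a - λ²`, the exponent per coordinate; the condition `a ≤ 2/3`
  -- keeps the weights below `1/3`.
  have h := measureReal_le_sum_normSq_of_sum_eq_zero hX (l := fun k => a / 2 * (c k).re)
    (fun k => by
      rw [abs_mul, abs_of_pos (by positivity)]
      nlinarith [hre k, abs_nonneg (c k).re])
    (by rw [← Finset.mul_sum, ← Complex.re_sum, h0]; simp) (a / 2 * (a * Fintype.card κ))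
  have h1 : {ω | a * Fintype.card κ ≤ (∑ k, c k * (‖X ω k‖ ^ 2 : ℝ)).re}
      = {ω | a / 2 * (a * Fintype.card κ) ≤ ∑ k, a / 2 * (c k).re * ‖X ω k‖ ^ 2} := by
    ext ω
    simp only [Set.mem_ofPred_eq, Complex.re_sum, Complex.re_mul_ofReal, mul_assoc]
    rw [← Finset.mul_sum, mul_le_mul_iff_of_pos_left (by positivity)]
  rw [h1]
  refine h.trans (Real.exp_le_exp.2 ?_)
  have h2 : ∑ k, (a / 2 * (c k).re) ^ 2 ≤ ∑ _k : κ, a ^ 2 / 4 := by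
    refine Finset.sum_le_sum fun k _ => ?_
    have : (c k).re ^ 2 ≤ 1 := (sq_le_one_iff_abs_le_one _).2 (hre k)
    nlinarith [sq_nonneg a]
  rw [Finset.sum_const, Finset.card_univ, nsmul_eq_mul] at h2
  linarith

/-! ### Polarization for products of independent Gaussians -/

lemma sum_prod_bool {κ : Type*} [Fintype κ] (f : κ × Bool → ℝ) :
    ∑ p, f p = ∑ k, (f (k, true) + f (k, false)) := by
  rw [Fintype.sum_prod_type]
  simp

/-- The matrix which sends the pairs `(a k, b k)` to `((c k a k ± b k) / √2)`. -/
def polarizationMatrix {κ : Type*} [DecidableEq κ] (c : κ → ℂ) :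
    Matrix (κ × Bool) (κ × Bool) ℂ :=
  Matrix.of fun p q => if p.1 = q.1 then
    (Real.sqrt 2 : ℂ)⁻¹ * (if q.2 then c p.1 else if p.2 then 1 else -1) else 0

lemma sum_prod_bool_ite_mul {κ : Type*} [Fintype κ] [DecidableEq κ] (k : κ) (g : Bool → ℂ)
    (f : κ × Bool → ℂ) :
    ∑ q : κ × Bool, (if k = q.1 then g q.2 else 0) * f q
      = g true * f (k, true) + g false * f (k, false) := by
  rw [Fintype.sum_prod_type]
  simp

lemma polarizationMatrix_mulVec {κ : Type*} [Fintype κ] [DecidableEq κ] (c : κ → ℂ)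
    (x : κ × Bool → ℂ) (p : κ × Bool) :
    (polarizationMatrix c).mulVec x p = (Real.sqrt 2 : ℂ)⁻¹ *
      (c p.1 * x (p.1, true) + (if p.2 then 1 else -1) * x (p.1, false)) := by
  simp only [polarizationMatrix, Matrix.mulVec, dotProduct, Matrix.of_apply]
  rw [sum_prod_bool_ite_mul p.1 (fun b =>
    (Real.sqrt 2 : ℂ)⁻¹ * (if b then c p.1 else if p.2 then 1 else -1))]
  cases p.2 <;> simp <;> ring

lemma inv_sqrt_two_mul_self : (Real.sqrt 2 : ℂ)⁻¹ * (Real.sqrt 2 : ℂ)⁻¹ = 1 / 2 := by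
  rw [← mul_inv, ← Complex.ofReal_mul, Real.mul_self_sqrt zero_le_two]
  norm_num

lemma polarizationMatrix_mul_conjTranspose {κ : Type*} [Fintype κ] [DecidableEq κ] {c : κ → ℂ}
    (hc : ∀ k, ‖c k‖ = 1) :
    polarizationMatrix c * (polarizationMatrix c).conjTranspose = (((1 : ℝ≥0) : ℝ) : ℂ) • 1 := by
  ext ⟨k, b⟩ ⟨k', b'⟩
  have hcc : ∀ k, c k * (starRingEnd ℂ) (c k) = 1 := fun k => by
    rw [Complex.mul_conj', hc]; simp
  have h2 := inv_sqrt_two_mul_self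
  rw [Matrix.mul_apply]
  simp only [polarizationMatrix, Matrix.conjTranspose_apply, Matrix.of_apply]
  rw [sum_prod_bool_ite_mul k (fun d =>
    (Real.sqrt 2 : ℂ)⁻¹ * (if d then c k else if b then 1 else -1))]
  by_cases hk : k = k'
  · subst hk
    have e1 : ∀ z w : ℂ, (Real.sqrt 2 : ℂ)⁻¹ * z * ((Real.sqrt 2 : ℂ)⁻¹ * w) = 1 / 2 * (z * w) := by
      intro z w
      rw [← h2]; ring
    cases b <;> cases b' <;> simp <;> rw [e1, hcc, h2] <;> norm_num
  · have : k' ≠ k := fun h => hk h.symm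
    simp [this, hk]

/-- With `u± = (c x ± y) / √2` one has `Re (c x ȳ) = (|u₊|² - |u₋|²) / 2`, and the `u±` are again
independent standard Gaussians. The weights `± a / 2` sum to zero without any condition on `∑ c k`.
-/
lemma measureReal_le_sum_re_mul_conj {Ω κ : Type*} [MeasurableSpace Ω] {P : Measure Ω}
    [IsProbabilityMeasure P] [Fintype κ] [DecidableEq κ] {X : Ω → κ × Bool → ℂ}
    (hX : HasLaw X (Measure.pi fun _ => complexGaussian 1) P) {c : κ → ℂ}
    (hc : ∀ k, ‖c k‖ = 1) {a : ℝ} (ha : 0 < a) (ha' : a ≤ 2 / 3) :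
    P.real {ω | a * Fintype.card κ ≤
        (∑ k, c k * (X ω (k, true) * (starRingEnd ℂ) (X ω (k, false)))).re}
      ≤ Real.exp (-(a ^ 2 / 2 * Fintype.card κ)) := by
  have hY := hasLaw_mulVec (polarizationMatrix_mul_conjTranspose hc) hX
  rw [one_mul] at hY
  have h := measureReal_le_sum_normSq_of_sum_eq_zero hY
    (l := fun p => a * (if p.2 then 1 / 2 else -(1 / 2)))
    (fun p => by
      rcases p with ⟨_, _ | _⟩ <;> simp [abs_of_pos ha, abs_mul] <;> linarith)
    (by rw [sum_prod_bool]; simp) (a * (a * Fintype.card κ))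
  have h1 : {ω | a * Fintype.card κ ≤
        (∑ k, c k * (X ω (k, true) * (starRingEnd ℂ) (X ω (k, false)))).re}
      = {ω | a * (a * Fintype.card κ) ≤ ∑ p, (a * (if p.2 then 1 / 2 else -(1 / 2)))
        * ‖(polarizationMatrix c).mulVec (X ω) p‖ ^ 2} := by
    ext ω
    simp only [Set.mem_ofPred_eq, mul_assoc]
    rw [← Finset.mul_sum, mul_le_mul_iff_of_pos_left ha, sum_prod_bool, Complex.re_sum]
    refine iff_of_eq (congrArg _ (Finset.sum_congr rfl fun k _ => ?_))
    simp only [polarizationMatrix_mulVec, norm_mul, mul_pow]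
    have h2 : ‖((Real.sqrt 2 : ℝ) : ℂ)⁻¹‖ ^ 2 = 1 / 2 := by
      rw [norm_inv, Complex.norm_real, inv_pow, Real.norm_eq_abs, sq_abs, Real.sq_sqrt zero_le_two]
      norm_num
    rw [h2]
    simp only [Complex.sq_norm, Complex.normSq_apply]
    simp
    ring
  rw [h1]
  refine h.trans (Real.exp_le_exp.2 (le_of_eq ?_))
  rw [sum_prod_bool]
  simp
  ring

/-! ### Discrete Fourier analysis of cyclic correlations -/

section DFT

variable {n : ℕ} [NeZero n]

lemma conj_stdAddChar (x : ZMod n) :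
    conj (ZMod.stdAddChar x : ℂ) = ZMod.stdAddChar (-x) :=
  (AddChar.map_neg_eq_conj ZMod.stdAddChar x).symm

lemma norm_stdAddChar (x : ZMod n) : ‖(ZMod.stdAddChar x : ℂ)‖ = 1 := by
  rw [ZMod.stdAddChar_apply]
  exact Circle.norm_coe _

lemma sum_stdAddChar_mul {b : ZMod n} (hb : b ≠ 0) :
    ∑ x, (ZMod.stdAddChar (x * b) : ℂ) = 0 := by
  rw [AddChar.sum_mulShift b (ZMod.isPrimitive_stdAddChar n), if_neg hb]
  simp

lemma sum_dft_mul_conj_dft (Φ Ψ : ZMod n → ℂ) :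
    ∑ f, ZMod.dft Φ f * conj (ZMod.dft Ψ f) = n * ∑ r, Φ r * conj (Ψ r) := by
  have hn : (n : ℂ) ≠ 0 := NeZero.ne _
  have h : ∀ r, ∑ f, (ZMod.stdAddChar (f * r) : ℂ) * ZMod.dft Φ f = n * Φ r := by
    intro r
    have := ZMod.invDFT_apply (ZMod.dft Φ) r
    rw [LinearEquiv.symm_apply_apply] at this
    rw [this]
    simp [hn]
  simp_rw [ZMod.dft_apply Ψ, map_sum, Finset.mul_sum]
  rw [Finset.sum_comm]
  refine Finset.sum_congr rfl fun r _ => ?_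
  rw [← mul_assoc, ← h, Finset.sum_mul]
  refine Finset.sum_congr rfl fun f _ => ?_
  rw [smul_eq_mul, map_mul, conj_stdAddChar, neg_neg, mul_comm r f]
  ring

lemma sum_norm_sq_dft (Φ : ZMod n → ℂ) :
    ∑ f, ‖ZMod.dft Φ f‖ ^ 2 = n * ∑ r, ‖Φ r‖ ^ 2 := by
  have h := sum_dft_mul_conj_dft Φ Φ
  simp only [Complex.mul_conj'] at h
  exact_mod_cast h

lemma dft_comp_sub (Φ : ZMod n → ℂ) (p f : ZMod n) :
    ZMod.dft (fun r => Φ (r - p)) f = ZMod.stdAddChar (-(p * f)) * ZMod.dft Φ f := by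
  rw [ZMod.dft_apply, ZMod.dft_apply, Finset.mul_sum, ← Equiv.sum_comp (Equiv.addRight p)]
  refine Finset.sum_congr rfl fun r _ => ?_
  simp only [Equiv.coe_addRight, add_sub_cancel_right, smul_eq_mul]
  rw [← mul_assoc, ← AddChar.map_add_eq_mul]
  congr 2
  ring

/-- The unitary discrete Fourier transform. -/
def unitaryDFT (Φ : ZMod n → ℂ) (f : ZMod n) : ℂ := (Real.sqrt n : ℂ)⁻¹ * ZMod.dft Φ f

lemma inv_sqrt_mul_self (x : ℝ) (hx : 0 ≤ x) :
    (Real.sqrt x : ℂ)⁻¹ * (Real.sqrt x : ℂ)⁻¹ = (x : ℂ)⁻¹ := by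
  rw [← mul_inv, ← Complex.ofReal_mul, Real.mul_self_sqrt hx]

/-- Parseval combined with the shift theorem: only the relative delay survives, as a character. -/
lemma sum_sub_mul_conj_sub (Φ Ψ : ZMod n → ℂ) (p q : ZMod n) :
    ∑ r, Φ (r - p) * conj (Ψ (r - q))
      = ∑ f, ZMod.stdAddChar (f * (q - p)) * (unitaryDFT Φ f * conj (unitaryDFT Ψ f)) := by
  have hn : (n : ℂ) ≠ 0 := NeZero.ne _
  have h := sum_dft_mul_conj_dft (fun r => Φ (r - p)) (fun r => Ψ (r - q))
  rw [← mul_right_inj' hn, ← h, Finset.mul_sum]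
  refine Finset.sum_congr rfl fun f _ => ?_
  have hs := inv_sqrt_mul_self (n : ℝ) (Nat.cast_nonneg n)
  rw [Complex.ofReal_natCast] at hs
  rw [dft_comp_sub, dft_comp_sub, map_mul (starRingEnd ℂ), conj_stdAddChar, neg_neg, unitaryDFT,
    unitaryDFT, map_mul (starRingEnd ℂ), map_inv₀, Complex.conj_ofReal,
    show f * (q - p) = -(p * f) + q * f by ring,
    AddChar.map_add_eq_mul]
  calc _ = (n * (n : ℂ)⁻¹) * (ZMod.stdAddChar (-(p * f)) * ZMod.stdAddChar (q * f) *
        (ZMod.dft Φ f * conj (ZMod.dft Ψ f))) := by rw [mul_inv_cancel₀ hn]; ring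
    _ = _ := by rw [← hs]; ring

lemma sum_norm_sq_unitaryDFT (Φ : ZMod n → ℂ) :
    ∑ f, ‖unitaryDFT Φ f‖ ^ 2 = ∑ r, ‖Φ r‖ ^ 2 := by
  have h := sum_sub_mul_conj_sub Φ Φ 0 0
  simp only [sub_zero, mul_zero, AddChar.map_zero_eq_one, one_mul, Complex.mul_conj'] at h
  exact_mod_cast h.symm

/-- The energy of the cyclic cross-correlation of two sequences. -/
lemma sum_norm_sq_correlation (y u : ZMod n → ℂ) :
    ∑ m, ‖∑ l, conj (y (l - m)) * u l‖ ^ 2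
      = (n : ℝ) * ∑ f, ‖unitaryDFT y f‖ ^ 2 * ‖unitaryDFT u f‖ ^ 2 := by
  have hn : (n : ℂ) ≠ 0 := NeZero.ne _
  -- A cyclic correlation is the inverse transform of the product spectrum `h`, so its energy
  -- follows from Parseval.
  set h : ZMod n → ℂ := fun f => n * (unitaryDFT u f * conj (unitaryDFT y f)) with hh
  have h1 : ∀ m, ∑ l, conj (y (l - m)) * u l = ZMod.dft.symm h m := by
    intro m
    have h2 := sum_sub_mul_conj_sub u y 0 m
    simp only [sub_zero] at h2
    rw [ZMod.invDFT_apply, Finset.smul_sum]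
    refine (Finset.sum_congr rfl fun l _ => mul_comm _ _).trans (h2.trans ?_)
    refine Finset.sum_congr rfl fun f _ => ?_
    rw [hh]
    simp only [smul_eq_mul]
    field_simp
  simp_rw [h1]
  have h3 := sum_norm_sq_dft (ZMod.dft.symm h)
  rw [LinearEquiv.apply_symm_apply] at h3
  have hn' : (n : ℝ) ≠ 0 := NeZero.ne _
  rw [← mul_right_inj' hn', ← h3, Finset.mul_sum, Finset.mul_sum]
  refine Finset.sum_congr rfl fun f _ => ?_
  simp only [hh, norm_mul, Complex.norm_natCast, RCLike.norm_conj]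
  ring

/-- Matrix of the map which combines the sequences `y i` with the weights `a j i` and takes the
unitary discrete Fourier transform. -/
def beamDFTMatrix {I J : Type*} (n : ℕ) [NeZero n] (a : J → I → ℂ) :
    Matrix (ZMod n × J) (I × ZMod n) ℂ :=
  Matrix.of fun p q =>
    (Real.sqrt n : ℂ)⁻¹ * (ZMod.stdAddChar (-(q.2 * p.1)) * a p.2 q.1)

lemma beamDFTMatrix_mulVec {I J : Type*} [Fintype I] (a : J → I → ℂ)
    (y : I × ZMod n → ℂ) (p : ZMod n × J) :
    (beamDFTMatrix n a).mulVec y p = unitaryDFT (fun r => ∑ i, a p.2 i * y (i, r)) p.1 := by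
  simp only [beamDFTMatrix, Matrix.mulVec, dotProduct, Matrix.of_apply, unitaryDFT, ZMod.dft_apply,
    Fintype.sum_prod_type, Finset.mul_sum, smul_eq_mul]
  rw [Finset.sum_comm]
  refine Finset.sum_congr rfl fun r _ => Finset.sum_congr rfl fun i _ => ?_
  ring

lemma beamDFTMatrix_mul_conjTranspose {I J : Type*} [Fintype I] [DecidableEq J]
    {a : J → I → ℂ} {c : ℝ≥0}
    (ha : ∀ j j', ∑ i, a j i * conj (a j' i) = if j = j' then ((c : ℝ) : ℂ) else 0) :
    beamDFTMatrix n a * (beamDFTMatrix n a).conjTranspose = ((c : ℝ) : ℂ) • 1 := by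
  have hn : (n : ℂ) ≠ 0 := NeZero.ne _
  ext ⟨f, j⟩ ⟨f', j'⟩
  have hs := inv_sqrt_mul_self (n : ℝ) (Nat.cast_nonneg n)
  rw [Complex.ofReal_natCast] at hs
  have h1 : ∀ (r : ZMod n), (ZMod.stdAddChar (-(r * f)) : ℂ) * ZMod.stdAddChar (r * f')
      = ZMod.stdAddChar (r * (f' - f)) := by
    intro r
    rw [← AddChar.map_add_eq_mul]
    ring_nf
  have h2 : (beamDFTMatrix n a * (beamDFTMatrix n a).conjTranspose) (f, j) (f', j')
      = (n : ℂ)⁻¹ * ((∑ r : ZMod n, (ZMod.stdAddChar (r * (f' - f)) : ℂ))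
        * ∑ i, a j i * conj (a j' i)) := by
    rw [Matrix.mul_apply, Fintype.sum_prod_type, Finset.sum_mul_sum, Finset.sum_comm,
      Finset.mul_sum]
    refine Finset.sum_congr rfl fun r _ => ?_
    rw [Finset.mul_sum]
    refine Finset.sum_congr rfl fun i _ => ?_
    rw [← h1, ← hs]
    simp only [beamDFTMatrix, Matrix.conjTranspose_apply, Matrix.of_apply, RCLike.star_def, map_mul,
      map_inv₀, Complex.conj_ofReal, conj_stdAddChar, neg_neg]
    ring
  rw [h2, ha]
  by_cases hf : f = f'
  · subst hf
    by_cases hj : j = j'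
    · simp [hj, hn]
    · simp [hj]
  · rw [sum_stdAddChar_mul (sub_ne_zero.2 (Ne.symm hf))]
    simp [hf]

/-- The Fourier coefficients of orthogonal combinations of white noise are white noise. -/
lemma hasLaw_unitaryDFT {Ω I J : Type*} [MeasurableSpace Ω] {P : Measure Ω} [Fintype I] [Fintype J]
    [DecidableEq J] {v c : ℝ≥0} {y : Ω → I × ZMod n → ℂ}
    (hy : HasLaw y (Measure.pi fun _ => complexGaussian v) P) {a : J → I → ℂ}
    (ha : ∀ j j', ∑ i, a j i * conj (a j' i) = if j = j' then ((c : ℝ) : ℂ) else 0) :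
    HasLaw (fun ω (p : ZMod n × J) => unitaryDFT (fun r => ∑ i, a p.2 i * y ω (i, r)) p.1)
      (Measure.pi fun _ => complexGaussian (c * v)) P := by
  have h := hasLaw_mulVec (beamDFTMatrix_mul_conjTranspose (n := n) ha) hy
  refine h.congr (Filter.Eventually.of_forall fun ω => ?_)
  funext p
  exact (beamDFTMatrix_mulVec a (y ω) p).symm

end DFT

/-! ### Column normalization, coherence and operator norm -/

lemma coherence_le_one {m k : Type*} [Fintype m] (M : Matrix m k ℂ) : coherence M ≤ 1 :=
  Real.iSup_le (fun _ => div_le_one_of_le₀ (norm_inner_le_norm _ _) (by positivity)) zero_le_one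

section Columns

variable {m k : Type*} [Fintype m] [Fintype k] [DecidableEq k]

lemma normalizeColumns_apply {M : Matrix m k ℂ} (hM : ∀ j, 0 < ‖column M j‖) (i : m) (j : k) :
    normalizeColumns M i j = M i j * ((‖column M j‖ : ℝ) : ℂ)⁻¹ := by
  have h : (columnNormMatrix M)⁻¹
      = Matrix.diagonal fun j => ((‖column M j‖ : ℝ) : ℂ)⁻¹ := by
    refine Matrix.inv_eq_right_inv ?_
    rw [columnNormMatrix, Matrix.diagonal_mul_diagonal, ← Matrix.diagonal_one]
    congr 1
    funext j
    exact mul_inv_cancel₀ (Complex.ofReal_ne_zero.2 (hM j).ne')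
  rw [normalizeColumns, h, Matrix.mul_diagonal]

lemma column_normalizeColumns {M : Matrix m k ℂ} (hM : ∀ j, 0 < ‖column M j‖) (j : k) :
    column (normalizeColumns M) j = ((‖column M j‖ : ℝ) : ℂ)⁻¹ • column M j := by
  ext i
  simp [column, normalizeColumns_apply hM]
  ring

lemma norm_column_normalizeColumns {M : Matrix m k ℂ} (hM : ∀ j, 0 < ‖column M j‖) (j : k) :
    ‖column (normalizeColumns M) j‖ = 1 := by
  rw [column_normalizeColumns hM, norm_smul, norm_inv, Complex.norm_real, norm_norm]
  exact inv_mul_cancel₀ (hM j).ne'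

lemma coherence_normalizeColumns_le {M : Matrix m k ℂ} (hM : ∀ j, 0 < ‖column M j‖) {c : ℝ}
    (hc : 0 ≤ c)
    (h : ∀ i j, i ≠ j → ‖inner ℂ (column M i) (column M j)‖ ≤ c * (‖column M i‖ * ‖column M j‖)) :
    coherence (normalizeColumns M) ≤ c := by
  refine Real.iSup_le (fun ⟨⟨i, j⟩, hij⟩ => ?_) hc
  simp only [norm_column_normalizeColumns hM, mul_one, div_one]
  rw [column_normalizeColumns hM, column_normalizeColumns hM, inner_smul_left, inner_smul_right,
    norm_mul, norm_mul, RCLike.norm_conj, norm_inv, norm_inv, Complex.norm_real, Complex.norm_real,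
    norm_norm, norm_norm, ← mul_assoc, ← mul_inv, inv_mul_le_iff₀ (mul_pos (hM i) (hM j))]
  exact (h i j hij).trans_eq (mul_comm _ _)

open scoped Matrix.Norms.L2Operator in
-- The norm is computed on the adjoint, whose output entries are inner products with the columns;
-- each normalization costs at most a factor `d⁻¹` in the square.
lemma opNorm_sq_normalizeColumns_le [DecidableEq m] {M : Matrix m k ℂ} {d K : ℝ} (hd : 0 < d)
    (hK : 0 ≤ K)
    (hM : ∀ j, d ≤ ‖column M j‖ ^ 2)
    (h : ∀ u : EuclideanSpace ℂ m, ∑ j, ‖inner ℂ (column M j) u‖ ^ 2 ≤ K * ‖u‖ ^ 2) :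
    opNorm (normalizeColumns M) ^ 2 ≤ K / d := by
  have hpos : ∀ j, 0 < ‖column M j‖ := fun j =>
    (norm_nonneg _).lt_of_ne fun h0 => by
      have := hM j
      rw [← h0] at this
      linarith
  have h1 : opNorm (normalizeColumns M) ≤ Real.sqrt (K / d) := by
    rw [opNorm, ← Matrix.l2_opNorm_conjTranspose, Matrix.l2_opNorm_def]
    refine ContinuousLinearMap.opNorm_le_bound _ (Real.sqrt_nonneg _) fun u => ?_
    refine le_of_sq_le_sq ?_ (by positivity)
    rw [mul_pow, Real.sq_sqrt (by positivity), EuclideanSpace.norm_sq_eq]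
    have h2 : ∀ j, ‖(((Matrix.toEuclideanLin (𝕜 := ℂ) (m := k) (n := m)).trans
        LinearMap.toContinuousLinearMap) (normalizeColumns M).conjTranspose u).ofLp j‖ ^ 2
        ≤ d⁻¹ * ‖inner ℂ (column M j) u‖ ^ 2 := by
      intro j
      have h3 : (((Matrix.toEuclideanLin (𝕜 := ℂ) (m := k) (n := m)).trans
        LinearMap.toContinuousLinearMap) (normalizeColumns M).conjTranspose u).ofLp j
          = inner ℂ (column (normalizeColumns M) j) u := by
        simp [Matrix.toEuclideanLin, Matrix.mulVec, dotProduct, column, PiLp.inner_apply, mul_comm]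
      rw [h3, column_normalizeColumns hpos, inner_smul_left, norm_mul, mul_pow, RCLike.norm_conj,
        norm_inv, Complex.norm_real, norm_norm, inv_pow]
      gcongr
      exact hM j
    refine (Finset.sum_le_sum fun j _ => h2 j).trans ?_
    rw [← Finset.mul_sum, div_mul_eq_mul_div, div_eq_inv_mul]
    gcongr
    exact h u
  calc opNorm (normalizeColumns M) ^ 2 ≤ Real.sqrt (K / d) ^ 2 :=
        pow_le_pow_left₀ (norm_nonneg _) h1 2
    _ = K / d := Real.sq_sqrt (by positivity)

end Columns

/-! ### Cyclic samples and the virtual array -/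

lemma bijective_natCast_fin (n : ℕ) [NeZero n] :
    Function.Bijective fun l : Fin n => ((l : ℕ) : ZMod n) := by
  rw [Fintype.bijective_iff_injective_and_card]
  refine ⟨fun a b h => ?_, by simp [ZMod.card]⟩
  have h1 := (ZMod.natCast_eq_natCast_iff' _ _ _).1 h
  rw [Nat.mod_eq_of_lt a.2, Nat.mod_eq_of_lt b.2] at h1
  exact Fin.ext h1

lemma sum_natCast_fin {n : ℕ} [NeZero n] {E : Type*} [AddCommMonoid E] (g : ZMod n → E) :
    ∑ l : Fin n, g ((l : ℕ) : ZMod n) = ∑ r, g r :=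
  (bijective_natCast_fin n).sum_comp g

/-- One period of the samples of the signals, indexed by the cyclic group. -/
def cyclicSamples {NT : ℕ} (n : ℕ) (Δt : ℝ) (s : Fin NT → ℝ → ℂ) (i : Fin NT) (r : ZMod n) : ℂ :=
  s i (r.val * Δt)

lemma cyclicSamples_intCast {NT n : ℕ} [NeZero n] {Δt : ℝ} {s : Fin NT → ℝ → ℂ}
    (hs : ∀ i, Function.Periodic (s i) (n * Δt)) (i : Fin NT) (z : ℤ) :
    cyclicSamples n Δt s i (z : ZMod n) = s i (z * Δt) := by
  have h1 : (((z : ZMod n).val : ℤ) : ℝ) = (z : ℝ) - (z / n : ℤ) * n := by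
    rw [ZMod.val_intCast, Int.emod_def]
    push_cast
    ring
  rw [Int.cast_natCast] at h1
  rw [cyclicSamples, h1, sub_mul, mul_assoc]
  exact (hs i).sub_int_mul_eq _

/-- Sampling times and delays both start at one step, so the two offsets cancel in the difference.
-/
lemma delayedSignals_apply {NT n : ℕ} [NeZero n] {Δt : ℝ} {s : Fin NT → ℝ → ℂ}
    (hs : ∀ i, Function.Periodic (s i) (n * Δt)) (m : ℕ) (l : Fin n) (i : Fin NT) :
    delayedSignals n Δt s (((m : ℝ) + 1) * Δt) l i
      = cyclicSamples n Δt s i (((l : ℕ) : ZMod n) - (m : ZMod n)) := by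
  have h := cyclicSamples_intCast hs i ((l : ℤ) - m)
  push_cast at h
  rw [h, delayedSignals, Matrix.of_apply]
  congr 1
  ring

lemma responseMatrix_apply {NT NR n Nτ Nβ : ℕ} [NeZero n] {dT dR Δt Δβ : ℝ} {s : Fin NT → ℝ → ℂ}
    (hs : ∀ i, Function.Periodic (s i) (n * Δt)) (k : Fin NR) (l : Fin n)
    (p : Fin Nτ × Fin Nβ) :
    responseMatrix NR n Nτ Nβ dT dR Δt Δt Δβ s (k, l) p
      = arrayManifold NR dR (((p.2 : ℝ) + 1) * Δβ) k *
        ∑ i, arrayManifold NT dT (((p.2 : ℝ) + 1) * Δβ) i *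
          cyclicSamples n Δt s i (((l : ℕ) : ZMod n) - ((p.1 : ℕ) : ZMod n)) := by
  rw [responseMatrix, Matrix.of_apply, receivedSignal, Matrix.mul_apply, Finset.mul_sum]
  refine Finset.sum_congr rfl fun i _ => ?_
  rw [Matrix.transpose_apply, delayedSignals_apply hs, Matrix.vecMulVec_apply, mul_assoc]

lemma norm_arrayManifold (N : ℕ) (d β : ℝ) (k : Fin N) : ‖arrayManifold N d β k‖ = 1 := by
  rw [arrayManifold, show (2 * Real.pi * Complex.I * (d * β * (k : ℝ) : ℝ) : ℂ)
    = ((2 * Real.pi * (d * β * (k : ℝ)) : ℝ) : ℂ) * Complex.I by push_cast; ring]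
  exact Complex.norm_exp_ofReal_mul_I _

lemma bijective_finProd_natCast (a b : ℕ) [NeZero (a * b)] :
    Function.Bijective fun p : Fin a × Fin b => ((p.2 + b * p.1 : ℕ) : ZMod (a * b)) :=
  (bijective_natCast_fin (a * b)).comp finProdFinEquiv.bijective

lemma bijective_fin_succ (N : ℕ) [NeZero N] :
    Function.Bijective fun b : Fin N => (((b : ℕ) + 1 : ℕ) : ZMod N) := by
  have := (Equiv.addRight (1 : ZMod N)).bijective.comp (bijective_natCast_fin N)
  refine (congrArg Function.Bijective ?_).mp this
  funext b
  simp

/-- The array with the wider spacing supplies the leading digit and the other the trailing digit of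
a mixed-radix expansion, so antenna pairs enumerate the residues modulo `NR * NT`. The two spacing
conventions exchange the digits. -/
lemma arrayManifold_mul_arrayManifold {NT NR : ℕ} [NeZero (NR * NT)] {dT dR : ℝ}
    (hd : (dT = 1 / 2 ∧ dR = (NT : ℝ) / 2) ∨ (dT = (NR : ℝ) / 2 ∧ dR = 1 / 2)) :
    ∃ ψ : Fin NR × Fin NT → ZMod (NR * NT), Function.Bijective ψ ∧
      ∀ (b k i), arrayManifold NR dR (((b : ℕ) + 1) * (2 / ((NR : ℝ) * NT))) k
        * arrayManifold NT dT (((b : ℕ) + 1) * (2 / ((NR : ℝ) * NT))) i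
        = ZMod.stdAddChar (((b + 1 : ℕ) : ZMod (NR * NT)) * ψ (k, i)) := by
  have h0 : NR * NT ≠ 0 := NeZero.ne _
  have hR : (NR : ℂ) ≠ 0 := by
    rw [Nat.cast_ne_zero]; rintro rfl; simp at h0
  have hT : (NT : ℂ) ≠ 0 := by
    rw [Nat.cast_ne_zero]; rintro rfl; simp at h0
  rcases hd with ⟨rfl, rfl⟩ | ⟨rfl, rfl⟩
  · refine ⟨_, bijective_finProd_natCast NR NT, fun b k i => ?_⟩
    have h1 := ZMod.stdAddChar_coe (N := NR * NT) (((b + 1 : ℕ) * (i + NT * k : ℕ) : ℕ) : ℤ)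
    simp only [Int.cast_natCast] at h1
    rw [Nat.cast_mul] at h1
    rw [h1, arrayManifold, arrayManifold, ← Complex.exp_add]
    congr 1
    push_cast
    field_simp
    ring
  · have : NeZero (NT * NR) := ⟨by rwa [mul_comm]⟩
    have hb : Function.Bijective
        fun p : Fin NR × Fin NT => ((p.1 + NR * p.2 : ℕ) : ZMod (NR * NT)) := by
      have := (bijective_finProd_natCast NT NR).comp (Equiv.prodComm (Fin NR) (Fin NT)).bijective
      rw [mul_comm NR NT]
      exact this
    refine ⟨_, hb, fun b k i => ?_⟩
    have h1 := ZMod.stdAddChar_coe (N := NR * NT) (((b + 1 : ℕ) * (k + NR * i : ℕ) : ℕ) : ℤ)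
    simp only [Int.cast_natCast] at h1
    rw [Nat.cast_mul] at h1
    rw [h1, arrayManifold, arrayManifold, ← Complex.exp_add]
    congr 1
    push_cast
    field_simp

/-! ### Inner products of the columns -/

section Beams

variable {NT NR N : ℕ} [NeZero N] {J : Type*} {aR : J → Fin NR → ℂ}
  {aT : J → Fin NT → ℂ} {φ : J → ZMod N} {ψ : Fin NR × Fin NT → ZMod N}

/-- Distinct virtual array vectors are orthogonal. -/
lemma sum_conj_mul_sum_conj_eq_zero (hφ : Function.Injective φ) (hψ : Function.Bijective ψ)
    (h : ∀ b k i, aR b k * aT b i = ZMod.stdAddChar (φ b * ψ (k, i))) {b b' : J} (hb : b ≠ b') :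
    (∑ k, conj (aR b k) * aR b' k) * ∑ i, conj (aT b i) * aT b' i = 0 := by
  rw [Finset.sum_mul_sum, ← Fintype.sum_prod_type', ← sum_stdAddChar_mul
    (sub_ne_zero.2 (hφ.ne hb.symm)), ← hψ.sum_comp]
  refine Finset.sum_congr rfl fun p _ => ?_
  rw [show ψ p * (φ b' - φ b) = -(φ b * ψ p) + φ b' * ψ p by ring, AddChar.map_add_eq_mul,
    ← conj_stdAddChar, ← h b p.1 p.2, ← h b' p.1 p.2, map_mul]
  ring

/-- The virtual array vectors form a tight frame. -/
lemma sum_norm_sq_sum_conj_mul [Fintype J] (hφ : Function.Bijective φ) (hψ : Function.Bijective ψ)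
    (h : ∀ b k i, aR b k * aT b i = ZMod.stdAddChar (φ b * ψ (k, i)))
    (v : Fin NR → Fin NT → ℂ) :
    ∑ b, ‖∑ k, ∑ i, conj (aR b k * aT b i) * v k i‖ ^ 2 = N * ∑ k, ∑ i, ‖v k i‖ ^ 2 := by
  set e := Equiv.ofBijective ψ hψ with he
  set w : ZMod N → ℂ := fun x => v (e.symm x).1 (e.symm x).2 with hw
  have h1 : ∀ b, ∑ k, ∑ i, conj (aR b k * aT b i) * v k i = ZMod.dft w (φ b) := by
    intro b
    rw [ZMod.dft_apply, ← Fintype.sum_prod_type', ← e.sum_comp]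
    refine Finset.sum_congr rfl fun p _ => ?_
    simp only [hw, Equiv.symm_apply_apply, smul_eq_mul]
    rw [h, conj_stdAddChar, mul_comm (φ b)]
    rfl
  simp_rw [h1]
  rw [hφ.sum_comp (fun z => ‖ZMod.dft w z‖ ^ 2), sum_norm_sq_dft, ← Fintype.sum_prod_type',
    ← e.sum_comp]
  simp [hw]

variable {n Nτ : ℕ} [NeZero n] {y : Fin NT → ZMod n → ℂ}
  {M : Matrix (Fin NR × Fin n) (Fin Nτ × J) ℂ}

lemma inner_column_column
    (hM : ∀ k l p, M (k, l) p = aR p.2 k * ∑ i, aT p.2 i * y i ((l : ℕ) - (p.1 : ℕ)))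
    (p q : Fin Nτ × J) :
    inner ℂ (column M p) (column M q) = (∑ k, conj (aR p.2 k) * aR q.2 k) *
      ∑ f, ZMod.stdAddChar (f * (((p.1 : ℕ) : ZMod n) - ((q.1 : ℕ) : ZMod n))) *
        (unitaryDFT (fun r => ∑ i, aT q.2 i * y i r) f *
          conj (unitaryDFT (fun r => ∑ i, aT p.2 i * y i r) f)) := by
  rw [← sum_sub_mul_conj_sub, ← sum_natCast_fin, Finset.sum_mul_sum, PiLp.inner_apply,
    Fintype.sum_prod_type]
  refine Finset.sum_congr rfl fun k _ => Finset.sum_congr rfl fun l _ => ?_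
  simp only [column, hM, RCLike.inner_apply, map_mul]
  ring

lemma norm_sq_column (hR : ∀ b k, ‖aR b k‖ = 1)
    (hM : ∀ k l p, M (k, l) p = aR p.2 k * ∑ i, aT p.2 i * y i ((l : ℕ) - (p.1 : ℕ)))
    (p : Fin Nτ × J) :
    ‖column M p‖ ^ 2 = NR * ∑ f, ‖unitaryDFT (fun r => ∑ i, aT p.2 i * y i r) f‖ ^ 2 := by
  have h := inner_column_column hM p p
  rw [inner_self_eq_norm_sq_to_K] at h
  simp only [Complex.conj_mul', hR, sub_self, mul_zero, AddChar.map_zero_eq_one, one_mul,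
    Complex.mul_conj'] at h
  simp at h
  exact_mod_cast h

/-- The tight frame property removes the sum over directions, leaving the energies of the
correlations of every signal with every receive channel. Adding the missing delays can only increase
the sum, and over the full cycle the correlation energy is diagonal in frequency. -/
lemma sum_norm_sq_inner_column_le [Fintype J] (hφ : Function.Bijective φ) (hψ : Function.Bijective ψ)
    (h : ∀ b k i, aR b k * aT b i = ZMod.stdAddChar (φ b * ψ (k, i)))
    (hM : ∀ k l p, M (k, l) p = aR p.2 k * ∑ i, aT p.2 i * y i ((l : ℕ) - (p.1 : ℕ)))
    (hτ : Nτ ≤ n) {G : ℝ} (hG : ∀ f, ∑ i, ‖unitaryDFT (y i) f‖ ^ 2 ≤ G)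
    (u : EuclideanSpace ℂ (Fin NR × Fin n)) :
    ∑ p, ‖inner ℂ (column M p) u‖ ^ 2 ≤ N * n * G * ‖u‖ ^ 2 := by
  set e := Equiv.ofBijective _ (bijective_natCast_fin n) with he
  set U : Fin NR → ZMod n → ℂ := fun k r => u (k, e.symm r) with hU
  have hUe : ∀ k (l : Fin n), U k ((l : ℕ) : ZMod n) = u (k, l) := fun k l => by
    have : e.symm ((l : ℕ) : ZMod n) = l := e.symm_apply_apply l
    simp only [hU, this]
  set c : ZMod n → Fin NR → Fin NT → ℂ := fun m k i => ∑ r, conj (y i (r - m)) * U k r with hc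
  have h1 : ∀ p : Fin Nτ × J, inner ℂ (column M p) u
      = ∑ k, ∑ i, conj (aR p.2 k * aT p.2 i) * c ((p.1 : ℕ) : ZMod n) k i := by
    intro p
    rw [PiLp.inner_apply, Fintype.sum_prod_type]
    refine Finset.sum_congr rfl fun k _ => ?_
    simp only [hc, Finset.mul_sum]
    rw [Finset.sum_comm, ← sum_natCast_fin]
    refine Finset.sum_congr rfl fun l _ => ?_
    rw [hUe]
    simp only [column, hM, RCLike.inner_apply, map_mul, map_sum, Finset.mul_sum]
    exact Finset.sum_congr rfl fun i _ => by ring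
  have h2 : ∑ p, ‖inner ℂ (column M p) u‖ ^ 2
      = N * ∑ m : Fin Nτ, ∑ k, ∑ i, ‖c ((m : ℕ) : ZMod n) k i‖ ^ 2 := by
    rw [Fintype.sum_prod_type, Finset.mul_sum]
    refine Finset.sum_congr rfl fun m _ => ?_
    rw [← sum_norm_sq_sum_conj_mul hφ hψ h]
    simp_rw [h1]
  have h3 : ∑ m : Fin Nτ, ∑ k, ∑ i, ‖c ((m : ℕ) : ZMod n) k i‖ ^ 2
      ≤ ∑ m : ZMod n, ∑ k, ∑ i, ‖c m k i‖ ^ 2 := by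
    rw [← sum_natCast_fin]
    have hinj : Function.Injective (Fin.castLE hτ) := Fin.castLE_injective hτ
    have := Finset.sum_le_sum_of_subset_of_nonneg
      (f := fun l : Fin n => ∑ k, ∑ i, ‖c ((l : ℕ) : ZMod n) k i‖ ^ 2)
      (Finset.subset_univ (Finset.univ.map ⟨_, hinj⟩)) (fun _ _ _ => by positivity)
    rwa [Finset.sum_map] at this
  have h4 : ∑ m : ZMod n, ∑ k, ∑ i, ‖c m k i‖ ^ 2
      = n * ∑ k, ∑ f, (∑ i, ‖unitaryDFT (y i) f‖ ^ 2) * ‖unitaryDFT (U k) f‖ ^ 2 := by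
    rw [Finset.sum_comm, Finset.mul_sum]
    refine Finset.sum_congr rfl fun k _ => ?_
    rw [Finset.sum_comm]
    simp only [hc, sum_norm_sq_correlation, Finset.sum_mul]
    rw [← Finset.mul_sum, Finset.sum_comm]
  have h5 : ∑ k, ∑ f, (∑ i, ‖unitaryDFT (y i) f‖ ^ 2) * ‖unitaryDFT (U k) f‖ ^ 2
      ≤ G * ‖u‖ ^ 2 := by
    rw [EuclideanSpace.norm_sq_eq, Fintype.sum_prod_type, Finset.mul_sum]
    refine Finset.sum_le_sum fun k _ => ?_
    have : ∑ l, ‖u (k, l)‖ ^ 2 = ∑ f, ‖unitaryDFT (U k) f‖ ^ 2 := by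
      rw [sum_norm_sq_unitaryDFT, ← sum_natCast_fin]
      simp_rw [hUe]
    rw [this, Finset.mul_sum]
    exact Finset.sum_le_sum fun f _ => mul_le_mul_of_nonneg_right (hG f) (by positivity)
  calc ∑ p, ‖inner ℂ (column M p) u‖ ^ 2
      ≤ N * (n * (G * ‖u‖ ^ 2)) := by
        rw [h2]
        gcongr
        rw [h4] at h3
        exact h3.trans (by gcongr)
    _ = N * n * G * ‖u‖ ^ 2 := by ring

end Beams

/-! ### Probability estimates for the transformed waveforms -/

lemma hasLaw_comp_injective {Ω ι κ : Type*} [MeasurableSpace Ω] {P : Measure Ω} [Fintype ι]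
    [Fintype κ] {v : ℝ≥0} {X : Ω → ι → ℂ}
    (hX : HasLaw X (Measure.pi fun _ => complexGaussian v) P) {e : κ → ι}
    (he : Function.Injective e) :
    HasLaw (fun ω k => X ω (e k)) (Measure.pi fun _ => complexGaussian v) P := by
  classical
  have hU : (Matrix.of fun (k : κ) (i : ι) => if e k = i then (1 : ℂ) else 0)
      * (Matrix.of fun (k : κ) (i : ι) => if e k = i then (1 : ℂ) else 0).conjTranspose
      = (((1 : ℝ≥0) : ℝ) : ℂ) • 1 := by
    ext k k'
    rw [Matrix.mul_apply]
    simp [Matrix.one_apply, he.eq_iff, eq_comm]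
  have h := hasLaw_mulVec hU hX
  rw [one_mul] at h
  refine h.congr (Filter.Eventually.of_forall fun ω => ?_)
  funext k
  simp [Matrix.mulVec, dotProduct]

lemma IsPeriodicWhiteNoise.hasLaw_cyclicSamples {Ω : Type*} [MeasurableSpace Ω] {P : Measure Ω}
    {NT n : ℕ} [NeZero n] {Δt : ℝ} {v : ℝ≥0} {s : Fin NT → ℝ → Ω → ℂ}
    (hs : IsPeriodicWhiteNoise P n (n * Δt) Δt v s) :
    HasLaw (fun ω (p : Fin NT × ZMod n) => cyclicSamples n Δt (fun i t => s i t ω) p.1 p.2)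
      (Measure.pi fun _ => complexGaussian v) P := by
  have h := hs.indep.hasLaw_pi fun p : Fin NT × Fin n => hs.law p.1 p.2
  -- The slot `l` is sampled at `(l + 1) Δt`, so the residue `r` belongs to the slot `(r - 1).val`;
  -- residue `0` uses the last sample, by periodicity.
  have hinj : Function.Injective fun p : Fin NT × ZMod n =>
      ((p.1, ⟨(p.2 - 1).val, ZMod.val_lt _⟩) : Fin NT × Fin n) := by
    rintro ⟨i, r⟩ ⟨i', r'⟩ hp
    simp only [Prod.mk.injEq, Fin.mk.injEq] at hp
    rw [hp.1, sub_left_injective (ZMod.val_injective n hp.2)]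
  refine (hasLaw_comp_injective h hinj).congr (Filter.Eventually.of_forall fun ω => ?_)
  funext p
  have h1 := cyclicSamples_intCast (s := fun i t => s i t ω) (fun i => hs.periodic i ω) p.1
    ((p.2 - 1).val + 1)
  push_cast at h1
  rw [ZMod.natCast_zmod_val, sub_add_cancel] at h1
  exact h1

/-- If all four quarter-turn rotations had real part below `r`, both coordinates would be below `r`
in absolute value. This trades a modulus for real parts at the cost of `√2` and four events. -/
lemma exists_le_re_I_pow_mul {z : ℂ} {r : ℝ} (h : Real.sqrt 2 * r ≤ ‖z‖) :
    ∃ d : Fin 4, r ≤ (Complex.I ^ (d : ℕ) * z).re := by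
  by_contra! hc
  have h0 := hc 0
  have h1 := hc 1
  have h2 := hc 2
  have h3 := hc 3
  simp [pow_succ] at h0 h1 h2 h3
  have hr : 0 < r := by linarith
  have h4 : ‖z‖ ^ 2 < 2 * r ^ 2 := by
    rw [Complex.sq_norm, Complex.normSq_apply]
    nlinarith
  have h5 : (Real.sqrt 2 * r) ^ 2 ≤ ‖z‖ ^ 2 := pow_le_pow_left₀ (by positivity) h 2
  rw [mul_pow, Real.sq_sqrt zero_le_two] at h5
  linarith

lemma measureReal_exists_le {Ω α : Type*} [MeasurableSpace Ω] {P : Measure Ω} [IsProbabilityMeasure P]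
    [Fintype α] {p : α → Ω → Prop} {ε : ℝ} (h : ∀ a, P.real {ω | p a ω} ≤ ε) :
    P.real {ω | ∃ a, p a ω} ≤ Fintype.card α * ε := by
  have : {ω | ∃ a, p a ω} = ⋃ a, {ω | p a ω} := by
    ext; simp
  rw [this]
  refine (measureReal_iUnion_fintype_le _).trans ((Finset.sum_le_sum fun a _ => h a).trans_eq ?_)
  simp

lemma measureReal_sqrt_two_mul_le_norm {Ω : Type*} [MeasurableSpace Ω] {P : Measure Ω}
    [IsProbabilityMeasure P] {Z : Ω → ℂ} {r ε : ℝ}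
    (h : ∀ d : ℂ, ‖d‖ = 1 → P.real {ω | r ≤ (d * Z ω).re} ≤ ε) :
    P.real {ω | Real.sqrt 2 * r ≤ ‖Z ω‖} ≤ 4 * ε := by
  have h1 := measureReal_exists_le (p := fun (d : Fin 4) ω => r ≤ (Complex.I ^ (d : ℕ) * Z ω).re)
    (fun d => h _ (by simp))
  refine le_trans (measureReal_mono fun ω hω => exists_le_re_I_pow_mul hω) (h1.trans_eq ?_)
  simp

/-- Unimodular weights have total energy `NT`, which cancels the sample variance `1 / NT`. -/
lemma hasLaw_unitaryDFT_beam {Ω : Type*} [MeasurableSpace Ω] {P : Measure Ω} {NT n : ℕ}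
    [NeZero NT] [NeZero n] {y : Ω → Fin NT → ZMod n → ℂ}
    (hy : HasLaw (fun ω (p : Fin NT × ZMod n) => y ω p.1 p.2)
      (Measure.pi fun _ => complexGaussian (1 / NT)) P) {a : Fin NT → ℂ} (ha : ∀ i, ‖a i‖ = 1) :
    HasLaw (fun ω f => unitaryDFT (fun r => ∑ i, a i * y ω i r) f)
      (Measure.pi fun _ => complexGaussian 1) P := by
  have hNT : (NT : ℝ≥0) ≠ 0 := NeZero.ne _
  have h := hasLaw_unitaryDFT hy (c := NT) (a := fun (_ : Unit) i => a i) (by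
    simp [Complex.mul_conj', ha])
  rw [mul_one_div_cancel hNT] at h
  exact hasLaw_comp_injective h (e := fun f => (f, ())) fun _ _ hij => (Prod.mk.inj hij).1

section Noise

variable {Ω : Type*} [MeasurableSpace Ω] {P : Measure Ω} [IsProbabilityMeasure P] {NT n : ℕ}
  [NeZero NT] [NeZero n] {y : Ω → Fin NT → ZMod n → ℂ}

lemma measureReal_exists_le_sum_norm_sq_unitaryDFT
    (hy : HasLaw (fun ω (p : Fin NT × ZMod n) => y ω p.1 p.2)
      (Measure.pi fun _ => complexGaussian (1 / NT)) P) {x : ℝ} (hx : 0 < x) :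
    P.real {ω | ∃ f, 1 + x ≤ ∑ i, ‖unitaryDFT (y ω i) f‖ ^ 2}
      ≤ n * (Real.exp (-x) * (1 + x)) ^ NT := by
  have hNT : (NT : ℝ≥0) ≠ 0 := NeZero.ne _
  have hNT' : (0 : ℝ) < NT := Nat.cast_pos.2 (Nat.pos_of_ne_zero (NeZero.ne _))
  have hs : ((Real.sqrt NT : ℝ) : ℂ) * (Real.sqrt NT : ℝ) = NT := by
    rw [← Complex.ofReal_mul, Real.mul_self_sqrt hNT'.le, Complex.ofReal_natCast]
  -- The weights `√NT` times the identity keep the antennas separate and rescale their coefficients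
  -- to unit variance.
  have h := hasLaw_unitaryDFT hy (c := NT)
    (a := fun (j i : Fin NT) => if j = i then ((Real.sqrt NT : ℝ) : ℂ) else 0) (by
      intro j j'
      by_cases hj : j = j'
      · simp [hj, hs]
      · simp [hj, Ne.symm hj])
  rw [mul_one_div_cancel hNT] at h
  have h1 := measureReal_exists_le (P := P)
    (p := fun f ω => 1 + x ≤ ∑ i, ‖unitaryDFT (y ω i) f‖ ^ 2)
    (ε := (Real.exp (-x) * (1 + x)) ^ NT) fun f => by
      have h2 := measureReal_le_sum_normSq_const (hasLaw_comp_injective h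
        (e := fun i : Fin NT => (f, i)) fun _ _ hij => (Prod.mk.inj hij).2) hx
      rw [Fintype.card_fin] at h2
      refine le_trans (measureReal_mono fun ω hω => ?_) h2
      have h3 : ∀ j, ‖unitaryDFT (fun r => ∑ i, (if j = i then ((Real.sqrt NT : ℝ) : ℂ) else 0)
          * y ω i r) f‖ ^ 2 = NT * ‖unitaryDFT (y ω j) f‖ ^ 2 := by
        intro j
        simp only [ite_mul, zero_mul, Finset.sum_ite_eq, Finset.mem_univ, if_true]
        rw [unitaryDFT, unitaryDFT, ZMod.dft_const_mul, norm_mul, norm_mul, norm_mul,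
          Complex.norm_real, Real.norm_of_nonneg (Real.sqrt_nonneg _), mul_pow, mul_pow, mul_pow,
          Real.sq_sqrt hNT'.le]
        ring
      simp only [Set.mem_ofPred_eq] at hω ⊢
      simp_rw [h3]
      rw [← Finset.mul_sum]
      gcongr
  rwa [ZMod.card] at h1

lemma measureReal_sum_norm_sq_beam_le (hy : HasLaw (fun ω (p : Fin NT × ZMod n) => y ω p.1 p.2)
      (Measure.pi fun _ => complexGaussian (1 / NT)) P) {a : Fin NT → ℂ} (ha : ∀ i, ‖a i‖ = 1)
      {s : ℝ} (hs : 0 < s) (t : ℝ) :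
    P.real {ω | ∑ f, ‖unitaryDFT (fun r => ∑ i, a i * y ω i r) f‖ ^ 2 ≤ t * n}
      ≤ (Real.exp (s * t) * (1 + s)⁻¹) ^ n := by
  have h := measureReal_sum_normSq_le (hasLaw_unitaryDFT_beam hy ha) hs t
  rwa [ZMod.card] at h

lemma sqrt_two_mul_div_sqrt_two (t : ℝ) : Real.sqrt 2 * (t / Real.sqrt 2) = t :=
  mul_div_cancel₀ _ (Real.sqrt_ne_zero'.2 two_pos)

lemma div_sqrt_two_le {t u : ℝ} (ht : 0 < t) (htu : t ≤ u) : t / Real.sqrt 2 ≤ u :=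
  (div_le_self ht.le (Real.one_le_sqrt.2 one_le_two)).trans htu

lemma measureReal_le_norm_autocorrelation
    (hy : HasLaw (fun ω (p : Fin NT × ZMod n) => y ω p.1 p.2)
      (Measure.pi fun _ => complexGaussian (1 / NT)) P) {a : Fin NT → ℂ} (ha : ∀ i, ‖a i‖ = 1)
      {k : ZMod n} (hk : k ≠ 0) {t : ℝ} (ht : 0 < t) (ht' : t ≤ 2 / 3) :
    P.real {ω | t * n ≤ ‖∑ f, ZMod.stdAddChar (f * k) *
        (unitaryDFT (fun r => ∑ i, a i * y ω i r) f *
          conj (unitaryDFT (fun r => ∑ i, a i * y ω i r) f))‖}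
      ≤ 4 * Real.exp (-(t ^ 2 / 8 * n)) := by
  have h := measureReal_sqrt_two_mul_le_norm (P := P) (r := t / Real.sqrt 2 * n)
    (Z := fun ω => ∑ f, ZMod.stdAddChar (f * k) *
        (unitaryDFT (fun r => ∑ i, a i * y ω i r) f *
          conj (unitaryDFT (fun r => ∑ i, a i * y ω i r) f)))
    (ε := Real.exp (-(t ^ 2 / 8 * n))) fun d hd => by
      have h1 := measureReal_le_sum_re_mul_normSq (hasLaw_unitaryDFT_beam hy ha)
        (c := fun f => d * ZMod.stdAddChar (f * k))
        (fun f => by rw [norm_mul, hd, norm_stdAddChar, one_mul])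
        (by rw [← Finset.mul_sum, sum_stdAddChar_mul hk, mul_zero])
        (a := t / Real.sqrt 2) (by positivity) (div_sqrt_two_le ht ht')
      rw [ZMod.card, div_pow, Real.sq_sqrt zero_le_two] at h1
      simp only [Finset.mul_sum, Complex.mul_conj', ← mul_assoc]
      push_cast at h1
      refine h1.trans_eq ?_
      ring_nf
  simpa only [← mul_assoc, sqrt_two_mul_div_sqrt_two] using h

lemma measureReal_le_norm_crosscorrelation
    (hy : HasLaw (fun ω (p : Fin NT × ZMod n) => y ω p.1 p.2)
      (Measure.pi fun _ => complexGaussian (1 / NT)) P) {a b : Fin NT → ℂ} (ha : ∀ i, ‖a i‖ = 1)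
      (hb : ∀ i, ‖b i‖ = 1) (hab : ∑ i, conj (a i) * b i = 0) (k : ZMod n) {t : ℝ} (ht : 0 < t)
      (ht' : t ≤ 2 / 3) :
    P.real {ω | t * n ≤ ‖∑ f, ZMod.stdAddChar (f * k) *
        (unitaryDFT (fun r => ∑ i, b i * y ω i r) f *
          conj (unitaryDFT (fun r => ∑ i, a i * y ω i r) f))‖}
      ≤ 4 * Real.exp (-(t ^ 2 / 4 * n)) := by
  have hNT : (NT : ℝ≥0) ≠ 0 := NeZero.ne _
  have hba : ∑ i, a i * conj (b i) = 0 := by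
    have := congrArg conj hab
    simpa [map_sum] using this
  have hab' : ∑ i, b i * conj (a i) = 0 := by
    simpa only [mul_comm] using hab
  have hX := hasLaw_unitaryDFT hy (c := NT) (a := fun (j : Bool) i => if j then b i else a i) (by
    rintro (_ | _) (_ | _) <;> simp [Complex.mul_conj', ha, hb, hab', hba])
  rw [mul_one_div_cancel hNT] at hX
  have h := measureReal_sqrt_two_mul_le_norm (P := P) (r := t / Real.sqrt 2 * n)
    (Z := fun ω => ∑ f, ZMod.stdAddChar (f * k) *
        (unitaryDFT (fun r => ∑ i, b i * y ω i r) f *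
          conj (unitaryDFT (fun r => ∑ i, a i * y ω i r) f)))
    (ε := Real.exp (-(t ^ 2 / 4 * n))) fun d hd => by
      have h1 := measureReal_le_sum_re_mul_conj hX
        (c := fun f => d * ZMod.stdAddChar (f * k))
        (fun f => by rw [norm_mul, hd, norm_stdAddChar, one_mul])
        (a := t / Real.sqrt 2) (by positivity) (div_sqrt_two_le ht ht')
      rw [ZMod.card, div_pow, Real.sq_sqrt zero_le_two] at h1
      simp only [Finset.mul_sum, ← mul_assoc] at h1 ⊢
      refine h1.trans_eq ?_
      ring_nf
  simpa only [← mul_assoc, sqrt_two_mul_div_sqrt_two] using h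

end Noise

/-! ### Numerical inequalities -/

lemma one_add_le_exp_half {x : ℝ} (hx : 4 ≤ x) : 1 + x ≤ Real.exp (x / 2) := by
  have := Real.quadratic_le_exp_of_nonneg (x := x / 2) (by linarith)
  nlinarith

lemma four_le_log_128_le_five : 4 ≤ Real.log 128 ∧ Real.log 128 ≤ 5 := by
  have h : Real.log 128 = 7 * Real.log 2 := by
    rw [show (128 : ℝ) = 2 ^ 7 by norm_num, Real.log_pow]
    norm_num
  have h1 := Real.log_two_gt_d9
  have h2 := Real.log_two_lt_d9
  constructor <;> linarith

lemma four_le_log {n : ℕ} (hn : 128 ≤ n) : 4 ≤ Real.log n :=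
  four_le_log_128_le_five.1.trans
    (Real.log_le_log (by norm_num) (by exact_mod_cast hn))

lemma mul_pow_exp_neg_log_le {n NT : ℕ} (hn : 128 ≤ n) (hT : 1 ≤ NT) :
    n * (Real.exp (-Real.log n) * (1 + Real.log n)) ^ NT
      ≤ (n : ℝ) ^ (1 - 1 / 2 * Real.sqrt NT) := by
  have hn0 : (0 : ℝ) < n := by exact_mod_cast (by omega : 0 < n)
  have hx := four_le_log hn
  set x := Real.log n with hx'
  have h1 : Real.exp (-x) * (1 + x) ≤ Real.exp (-x / 2) := by
    calc Real.exp (-x) * (1 + x) ≤ Real.exp (-x) * Real.exp (x / 2) :=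
          mul_le_mul_of_nonneg_left (one_add_le_exp_half hx) (Real.exp_pos _).le
      _ = Real.exp (-x / 2) := by rw [← Real.exp_add]; ring_nf
  have hT' : (1 : ℝ) ≤ NT := by exact_mod_cast hT
  have h2 : Real.sqrt NT ≤ NT :=
    (Real.sqrt_le_left (by linarith)).2 (by nlinarith)
  have h3 : (Real.exp (-x) * (1 + x)) ^ NT ≤ Real.exp (-(1 / 2 * Real.sqrt NT * x)) := by
    refine (pow_le_pow_left₀ (by positivity) h1 NT).trans ?_
    rw [← Real.exp_nat_mul, Real.exp_le_exp]
    nlinarith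
  rw [Real.rpow_def_of_pos hn0, ← hx', show x * (1 - 1 / 2 * Real.sqrt NT)
    = x + -(1 / 2 * Real.sqrt NT * x) by ring, Real.exp_add, hx', Real.exp_log hn0]
  exact mul_le_mul_of_nonneg_left h3 hn0.le

/-- Chernoff at level `1/3` with the optimal parameter `2` decays at least like `exp (-2n/5)`. The
union factor `n²` costs at most `exp (3n/10)`, and the remaining rate `1/10` exceeds `(43/100)² /
2`. -/
lemma mul_pow_exp_two_thirds_le {n N : ℕ} (hn : 128 ≤ n) (hN : N ≤ n ^ 2) :
    N * (Real.exp (2 * (1 / 3)) * (1 + 2)⁻¹) ^ n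
      ≤ Real.exp (-((n : ℝ) * (Real.sqrt (1 / 3) - 1) ^ 2 / 2)) := by
  have hn0 : (0 : ℝ) < n := by exact_mod_cast (by omega : 0 < n)
  have hn1 : (128 : ℝ) ≤ n := by exact_mod_cast hn
  have h1 : Real.exp (2 * (1 / 3)) * (1 + 2)⁻¹ ≤ Real.exp (-(2 / 5)) := by
    -- `16/15 = 2/3 + 2/5`.
    have h2 : Real.exp (16 / 15) ≤ 3 := by
      rw [← Real.le_log_iff_exp_le (by norm_num)]
      have h3 : Real.log 3 = Real.log (3 / 2) + Real.log 2 := by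
        rw [← Real.log_mul (by norm_num) (by norm_num)]
        norm_num
      have h4 : Real.log (3 / 2) ≥ 2 / 5 := by
        rw [ge_iff_le, Real.le_log_iff_exp_le (by norm_num)]
        refine (Real.exp_bound' (by norm_num) (by norm_num) (n := 4) (by norm_num)).trans ?_
        norm_num [Finset.sum_range_succ, Nat.factorial]
      linarith [Real.log_two_gt_d9]
    have h5 : Real.exp (2 * (1 / 3)) = Real.exp (-(2 / 5)) * Real.exp (16 / 15) := by
      rw [← Real.exp_add]
      norm_num
    rw [h5, mul_assoc]
    refine mul_le_of_le_one_right (Real.exp_pos _).le ?_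
    rw [mul_inv_le_iff₀ (by norm_num)]
    linarith
  have hlog : Real.log n ≤ 15 / 100 * n := by
    have h6 : Real.log n = Real.log 128 + Real.log (n / 128) := by
      rw [← Real.log_mul (by norm_num) (by positivity)]
      congr 1
      ring
    have h7 := Real.log_le_sub_one_of_pos (show (0 : ℝ) < n / 128 by positivity)
    linarith [four_le_log_128_le_five.2]
  have hN' : (N : ℝ) ≤ Real.exp (3 / 10 * n) := by
    calc (N : ℝ) ≤ (n : ℝ) ^ 2 := by exact_mod_cast hN
      _ = Real.exp (2 * Real.log n) := by
        rw [two_mul, Real.exp_add, Real.exp_log hn0, sq]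
      _ ≤ Real.exp (3 / 10 * n) := Real.exp_le_exp.2 (by linarith)
  have hs : (57 / 100 : ℝ) ≤ Real.sqrt (1 / 3) := Real.le_sqrt_of_sq_le (by norm_num)
  have hs1 : Real.sqrt (1 / 3) ≤ 1 := Real.sqrt_le_one.2 (by norm_num)
  calc N * (Real.exp (2 * (1 / 3)) * (1 + 2)⁻¹) ^ n
      ≤ Real.exp (3 / 10 * n) * Real.exp (-(2 / 5)) ^ n := by gcongr
    _ = Real.exp (-(1 / 10 * n)) := by
      rw [← Real.exp_nat_mul, ← Real.exp_add]
      ring_nf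
    _ ≤ _ := by
      rw [Real.exp_le_exp]
      have : (Real.sqrt (1 / 3) - 1) ^ 2 ≤ (43 / 100) ^ 2 := by
        rw [← sq_abs, abs_of_nonpos (by linarith)]
        exact pow_le_pow_left₀ (by linarith) (by linarith) 2
      nlinarith

lemma pow_exp_third_le {n : ℕ} {L : ℝ} (hL : 36 * L ≤ n) :
    (Real.exp (1 / 2 * (2 / 3)) * (1 + 1 / 2)⁻¹) ^ n ≤ Real.exp (-(2 * L)) := by
  have h2 : Real.exp (7 / 18) ≤ 3 / 2 := by
    refine (Real.exp_bound' (by norm_num) (by norm_num) (n := 4) (by norm_num)).trans ?_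
    norm_num [Finset.sum_range_succ, Nat.factorial]
  have h1 : Real.exp (1 / 2 * (2 / 3)) * (1 + 1 / 2)⁻¹ ≤ Real.exp (-(1 / 18)) := by
    have h5 : Real.exp (1 / 2 * (2 / 3)) = Real.exp (-(1 / 18)) * Real.exp (7 / 18) := by
      rw [← Real.exp_add]
      norm_num
    rw [h5, mul_assoc]
    refine mul_le_of_le_one_right (Real.exp_pos _).le ?_
    rw [mul_inv_le_iff₀ (by norm_num)]
    linarith
  refine (pow_le_pow_left₀ (by positivity) h1 n).trans ?_
  rw [← Real.exp_nat_mul, Real.exp_le_exp]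
  linarith

/-! ### From good events to the two bounds -/

/-- Only monotonicity and subadditivity are used, so neither event has to be measurable. -/
lemma one_sub_measureReal_le {Ω : Type*} [MeasurableSpace Ω] {P : Measure Ω}
    [IsProbabilityMeasure P] {S B : Set Ω} (h : ∀ ω, ω ∉ B → ω ∈ S) :
    1 - P.real B ≤ P.real S := by
  have h1 : (1 : ℝ) = P.real Set.univ := by simp
  have h2 : Set.univ ⊆ S ∪ B := fun ω _ => by
    by_cases hω : ω ∈ B
    · exact Or.inr hω
    · exact Or.inl (h ω hω)
  have h3 := (measureReal_mono (μ := P) h2).trans (measureReal_union_le S B)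
  linarith

/-- The deterministic half of the coherence bound. The receive factor is at most `NR`, and column
norms above `√(2 NR n / 3)` produce the factor `3/2`. Positive lags suffice for `hauto` by symmetry
of the inner product. -/
lemma coherence_normalizeColumns_le_of_correlation_le {NT NR N n Nτ : ℕ} [NeZero NR] [NeZero N]
    [NeZero n] {y : Fin NT → ZMod n → ℂ} {aR : Fin N → Fin NR → ℂ} {aT : Fin N → Fin NT → ℂ}
    {φ : Fin N → ZMod N} {ψ : Fin NR × Fin NT → ZMod N}
    {M : Matrix (Fin NR × Fin n) (Fin Nτ × Fin N) ℂ} (hR : ∀ b k, ‖aR b k‖ = 1)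
    (hφ : Function.Bijective φ) (hψ : Function.Bijective ψ)
    (h : ∀ b k i, aR b k * aT b i = ZMod.stdAddChar (φ b * ψ (k, i)))
    (hM : ∀ k l p, M (k, l) p = aR p.2 k * ∑ i, aT p.2 i * y i ((l : ℕ) - (p.1 : ℕ)))
    {t : ℝ} (ht : 0 ≤ t)
    (hw : ∀ b, 2 / 3 * n < ∑ f, ‖unitaryDFT (fun r => ∑ i, aT b i * y i r) f‖ ^ 2)
    (hauto : ∀ (b) (k : Fin (Nτ - 1)), ‖∑ f, ZMod.stdAddChar (f * (((k : ℕ) + 1 : ℕ) : ZMod n)) *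
        (unitaryDFT (fun r => ∑ i, aT b i * y i r) f *
          conj (unitaryDFT (fun r => ∑ i, aT b i * y i r) f))‖ < t * n)
    (hcross : ∀ (p q : Fin Nτ × Fin N), ∑ i, conj (aT p.2 i) * aT q.2 i = 0 →
      ‖∑ f, ZMod.stdAddChar (f * (((p.1 : ℕ) : ZMod n) - ((q.1 : ℕ) : ZMod n))) *
        (unitaryDFT (fun r => ∑ i, aT q.2 i * y i r) f *
          conj (unitaryDFT (fun r => ∑ i, aT p.2 i * y i r) f))‖ < t * n) :
    coherence (normalizeColumns M) ≤ 3 / 2 * t := by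
  have hNR : (0 : ℝ) < NR := Nat.cast_pos.2 (Nat.pos_of_ne_zero (NeZero.ne _))
  have hn0 : (0 : ℝ) < n := Nat.cast_pos.2 (Nat.pos_of_ne_zero (NeZero.ne _))
  set w := NR * (2 / 3 * (n : ℝ)) with hw'
  have hw0 : 0 < w := by positivity
  have hcol : ∀ p, Real.sqrt w ≤ ‖column M p‖ := fun p => by
    rw [← Real.sqrt_sq (norm_nonneg (column M p)), norm_sq_column hR hM]
    exact Real.sqrt_le_sqrt (mul_le_mul_of_nonneg_left (hw p.2).le hNR.le)
  have hpos : ∀ p, 0 < ‖column M p‖ := fun p => (Real.sqrt_pos.2 hw0).trans_le (hcol p)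
  have hprod : ∀ p q, w ≤ ‖column M p‖ * ‖column M q‖ := fun p q => by
    rw [← Real.mul_self_sqrt hw0.le]
    exact mul_le_mul (hcol p) (hcol q) (Real.sqrt_nonneg _) (norm_nonneg _)
  have hRR : ∀ b b', ‖∑ k, conj (aR b k) * aR b' k‖ ≤ NR := fun b b' => by
    refine (norm_sum_le _ _).trans (le_of_eq ?_)
    simp [hR]
  have hfin : ∀ p q : Fin Nτ × Fin N,
      ‖∑ f, ZMod.stdAddChar (f * (((p.1 : ℕ) : ZMod n) - ((q.1 : ℕ) : ZMod n))) *
        (unitaryDFT (fun r => ∑ i, aT q.2 i * y i r) f *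
          conj (unitaryDFT (fun r => ∑ i, aT p.2 i * y i r) f))‖ < t * n →
      ‖inner ℂ (column M p) (column M q)‖
        ≤ 3 / 2 * t * (‖column M p‖ * ‖column M q‖) := by
    intro p q hpq
    rw [inner_column_column hM, norm_mul]
    calc _ ≤ NR * (t * n) := mul_le_mul (hRR _ _) hpq.le (norm_nonneg _) hNR.le
      _ = 3 / 2 * t * w := by rw [hw']; ring
      _ ≤ _ := mul_le_mul_of_nonneg_left (hprod p q) (by positivity)
  have hlt : ∀ p q : Fin Nτ × Fin N, p.2 = q.2 → q.1 < p.1 →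
      ‖inner ℂ (column M p) (column M q)‖
        ≤ 3 / 2 * t * (‖column M p‖ * ‖column M q‖) := by
    rintro ⟨m, b⟩ ⟨m', b'⟩ hb hm
    simp only at hb hm
    subst hb
    apply hfin
    have hm' : (m' : ℕ) < m := hm
    have h1 := hauto b ⟨(m : ℕ) - m' - 1, by omega⟩
    have h2 : (m : ℕ) - m' - 1 + 1 = (m : ℕ) - m' := by omega
    simp only [h2, Nat.cast_sub hm'.le] at h1
    exact h1
  refine coherence_normalizeColumns_le hpos (by positivity) fun p q hpq => ?_
  by_cases hb : p.2 = q.2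
  · rcases lt_trichotomy q.1 p.1 with hm | hm | hm
    · exact hlt p q hb hm
    · exact absurd (Prod.ext hm.symm hb) hpq
    · have := hlt q p hb.symm hm
      rwa [norm_inner_symm, mul_comm ‖column M q‖] at this
  · rcases mul_eq_zero.1 (sum_conj_mul_sum_conj_eq_zero hφ.1 hψ h hb) with h0 | h0
    · rw [inner_column_column hM, h0, zero_mul, norm_zero]
      positivity
    · exact hfin p q (hcross p q h0)

section Response

variable {Ω : Type*} [MeasurableSpace Ω] {P : Measure Ω} [IsProbabilityMeasure P]
  {NT NR N n Nτ : ℕ} [NeZero NT] [NeZero NR] [NeZero N] [NeZero n]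
  {y : Ω → Fin NT → ZMod n → ℂ} {aR : Fin N → Fin NR → ℂ} {aT : Fin N → Fin NT → ℂ}
  {φ : Fin N → ZMod N} {ψ : Fin NR × Fin NT → ZMod N}
  {M : Ω → Matrix (Fin NR × Fin n) (Fin Nτ × Fin N) ℂ}

lemma one_sub_le_measureReal_opNorm
    (hy : HasLaw (fun ω (p : Fin NT × ZMod n) => y ω p.1 p.2)
      (Measure.pi fun _ => complexGaussian (1 / NT)) P)
    (hR : ∀ b k, ‖aR b k‖ = 1) (hT : ∀ b k, ‖aT b k‖ = 1)
    (hφ : Function.Bijective φ) (hψ : Function.Bijective ψ)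
    (h : ∀ b k i, aR b k * aT b i = ZMod.stdAddChar (φ b * ψ (k, i)))
    (hM : ∀ ω k l p, M ω (k, l) p = aR p.2 k * ∑ i, aT p.2 i * y ω i ((l : ℕ) - (p.1 : ℕ)))
    (hN : N = NR * NT) (hn : 128 ≤ n) (hτ : Nτ ≤ n) (hNτ : N ≤ n ^ 2) :
    1 - (Real.exp (-((n : ℝ) * (Real.sqrt (1 / 3) - 1) ^ 2 / 2))
        + (n : ℝ) ^ (1 - 1 / 2 * Real.sqrt NT))
      ≤ P.real {ω | opNorm (normalizeColumns (M ω)) ^ 2 < 3 * NT * (1 + Real.log n)} := by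
  have hx := four_le_log hn
  have hNT : (0 : ℝ) < NT := Nat.cast_pos.2 (Nat.pos_of_ne_zero (NeZero.ne _))
  have hNR : (0 : ℝ) < NR := Nat.cast_pos.2 (Nat.pos_of_ne_zero (NeZero.ne _))
  have hn0 : (0 : ℝ) < n := Nat.cast_pos.2 (Nat.pos_of_ne_zero (NeZero.ne _))
  set x := Real.log n with hx'
  set B1 := {ω | ∃ f, 1 + x ≤ ∑ i, ‖unitaryDFT (y ω i) f‖ ^ 2}
  set B2 := {ω | ∃ b, ∑ f, ‖unitaryDFT (fun r => ∑ i, aT b i * y ω i r) f‖ ^ 2 ≤ 1 / 3 * n}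
  have hB1 : P.real B1 ≤ (n : ℝ) ^ (1 - 1 / 2 * Real.sqrt NT) :=
    (measureReal_exists_le_sum_norm_sq_unitaryDFT hy (by linarith)).trans
      (mul_pow_exp_neg_log_le hn (Nat.pos_of_ne_zero (NeZero.ne _)))
  have hB2 : P.real B2 ≤ Real.exp (-((n : ℝ) * (Real.sqrt (1 / 3) - 1) ^ 2 / 2)) := by
    refine (measureReal_exists_le fun b =>
      measureReal_sum_norm_sq_beam_le hy (hT b) two_pos (1 / 3)).trans ?_
    rw [Fintype.card_fin]
    exact mul_pow_exp_two_thirds_le hn hNτ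
  refine le_trans ?_ (one_sub_measureReal_le (B := B1 ∪ B2) fun ω hω => ?_)
  · linarith [measureReal_union_le (μ := P) B1 B2]
  · simp only [B1, B2, Set.mem_union, Set.mem_ofPred_eq, not_or, not_exists, not_le] at hω
    -- Taking `G` as an attained maximum preserves the strict inequality.
    obtain ⟨f₀, hf₀⟩ := Finite.exists_max fun f => ∑ i, ‖unitaryDFT (y ω i) f‖ ^ 2
    set G := ∑ i, ‖unitaryDFT (y ω i) f₀‖ ^ 2
    have hG : 0 ≤ G := Finset.sum_nonneg fun _ _ => by positivity
    have h1 := opNorm_sq_normalizeColumns_le (M := M ω) (d := NR * (1 / 3 * n)) (K := N * n * G)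
      (by positivity) (by positivity)
      (fun p => by
        rw [norm_sq_column hR (hM ω)]
        exact mul_le_mul_of_nonneg_left (hω.2 p.2).le hNR.le)
      (sum_norm_sq_inner_column_le hφ hψ h (hM ω) hτ hf₀)
    refine lt_of_le_of_lt h1 ?_
    rw [hN, show ((NR * NT : ℕ) : ℝ) * n * G / (NR * (1 / 3 * n)) = 3 * NT * G by
      push_cast; field_simp]
    exact mul_lt_mul_of_pos_left (hω.1 f₀) (by positivity)

lemma one_sub_le_measureReal_coherence
    (hy : HasLaw (fun ω (p : Fin NT × ZMod n) => y ω p.1 p.2)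
      (Measure.pi fun _ => complexGaussian (1 / NT)) P)
    (hR : ∀ b k, ‖aR b k‖ = 1) (hT : ∀ b k, ‖aT b k‖ = 1)
    (hφ : Function.Bijective φ) (hψ : Function.Bijective ψ)
    (h : ∀ b k i, aR b k * aT b i = ZMod.stdAddChar (φ b * ψ (k, i)))
    (hM : ∀ ω k l p, M ω (k, l) p = aR p.2 k * ∑ i, aT p.2 i * y ω i ((l : ℕ) - (p.1 : ℕ)))
    (hτ : Nτ ≤ n) (hNτ : N ≤ Nτ ^ 2) :
    1 - 2 * (N : ℝ)⁻¹ ≤ P.real {ω | coherence (normalizeColumns (M ω))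
      ≤ 6 * Real.sqrt (1 / n * Real.log (Nτ * N))} := by
  have hn0 : (0 : ℝ) < n := Nat.cast_pos.2 (Nat.pos_of_ne_zero (NeZero.ne _))
  have hN0 : (0 : ℝ) < N := Nat.cast_pos.2 (Nat.pos_of_ne_zero (NeZero.ne _))
  -- For `N ≤ 2` the claimed lower bound is not positive.
  rcases Nat.lt_or_ge N 3 with hN3 | hN3
  · have : (N : ℝ) ≤ 2 := by exact_mod_cast (by omega : N ≤ 2)
    have h1 : 1 ≤ 2 * (N : ℝ)⁻¹ := by
      rw [← div_eq_mul_inv, one_le_div hN0]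
      exact this
    exact le_trans (by linarith) measureReal_nonneg
  have hτ2 : 2 ≤ Nτ := by
    by_contra! hc
    have : Nτ ^ 2 ≤ 1 ^ 2 := Nat.pow_le_pow_left (by omega) 2
    omega
  have hτ2' : (2 : ℝ) ≤ Nτ := by exact_mod_cast hτ2
  have hN3' : (3 : ℝ) ≤ N := by exact_mod_cast hN3
  set L := Real.log (Nτ * N) with hL
  have hQ : (0 : ℝ) < Nτ * N := by positivity
  have hL0 : 0 < L := Real.log_pos (by nlinarith)
  -- If `n ≤ 36 L` the threshold is at least `1`, hence trivial; otherwise the choice of `t` below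
  -- satisfies `t ≤ 2/3`, as the tail bounds require.
  rcases le_or_gt (n : ℝ) (36 * L) with hnL | hnL
  · have h1 : (1 : ℝ) ≤ 6 * Real.sqrt (1 / n * L) := by
      have : (1 / 6 : ℝ) ≤ Real.sqrt (1 / n * L) := by
        refine Real.le_sqrt_of_sq_le ?_
        rw [one_div_mul_eq_div, le_div_iff₀ hn0]
        linarith
      linarith
    have h2 : {ω | coherence (normalizeColumns (M ω)) ≤ 6 * Real.sqrt (1 / n * L)} = Set.univ :=
      Set.eq_univ_of_forall fun ω => (coherence_le_one _).trans h1
    rw [h2, probReal_univ]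
    have : 0 ≤ 2 * (N : ℝ)⁻¹ := by positivity
    linarith
  set t := 4 * Real.sqrt (1 / n * L) with ht
  have ht0 : 0 < t := by positivity
  have ht2 : t ^ 2 * n = 16 * L := by
    rw [ht, mul_pow, Real.sq_sqrt (by positivity)]
    field_simp
    norm_num
  have ht3 : t ≤ 2 / 3 := by
    refine le_of_sq_le_sq ?_ (by norm_num)
    rw [← mul_le_mul_iff_of_pos_right hn0, ht2]
    linarith
  have hexp : Real.exp (-(2 * L)) = ((Nτ * N : ℝ) ^ 2)⁻¹ := by
    rw [Real.exp_neg, two_mul, Real.exp_add, hL, Real.exp_log hQ, sq]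
  have hexp4 : Real.exp (-(4 * L)) = ((Nτ * N : ℝ) ^ 4)⁻¹ := by
    rw [show -(4 * L) = -(2 * L) + -(2 * L) by ring, Real.exp_add, hexp]
    ring
  set B1 := {ω | ∃ b, ∑ f, ‖unitaryDFT (fun r => ∑ i, aT b i * y ω i r) f‖ ^ 2 ≤ 2 / 3 * n}
  -- Autocorrelation tails are only of order `Q⁻²` with `Q = Nτ N`, so the union runs over
  -- directions and positive lags; cross-correlation tails are of order `Q⁻⁴` and allow all `Q²`
  -- pairs.
  set B2 := {ω | ∃ c : Fin N × Fin (Nτ - 1), t * n ≤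
      ‖∑ f, ZMod.stdAddChar (f * (((c.2 : ℕ) + 1 : ℕ) : ZMod n)) *
        (unitaryDFT (fun r => ∑ i, aT c.1 i * y ω i r) f *
          conj (unitaryDFT (fun r => ∑ i, aT c.1 i * y ω i r) f))‖}
  set B3 := {ω | ∃ c : (Fin Nτ × Fin N) × (Fin Nτ × Fin N),
      ∑ i, conj (aT c.1.2 i) * aT c.2.2 i = 0 ∧ t * n ≤
      ‖∑ f, ZMod.stdAddChar (f * (((c.1.1 : ℕ) : ZMod n) - ((c.2.1 : ℕ) : ZMod n))) *
        (unitaryDFT (fun r => ∑ i, aT c.2.2 i * y ω i r) f *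
          conj (unitaryDFT (fun r => ∑ i, aT c.1.2 i * y ω i r) f))‖}
  have hB1 : P.real B1 ≤ N * ((Nτ * N : ℝ) ^ 2)⁻¹ := by
    rw [← hexp]
    refine (measureReal_exists_le fun b => (measureReal_sum_norm_sq_beam_le hy (hT b)
      one_half_pos (2 / 3)).trans (pow_exp_third_le hnL.le)).trans ?_
    rw [Fintype.card_fin]
  have hB2 : P.real B2 ≤ N * (Nτ - 1) * (4 * ((Nτ * N : ℝ) ^ 2)⁻¹) := by
    rw [← hexp]
    refine (measureReal_exists_le (ε := 4 * Real.exp (-(2 * L))) fun c => ?_).trans ?_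
    · refine (measureReal_le_norm_autocorrelation hy (hT c.1) ?_ ht0 ht3).trans (le_of_eq ?_)
      · rw [Ne, ZMod.natCast_eq_zero_iff]
        intro hdvd
        have := Nat.le_of_dvd (by omega) hdvd
        have := c.2.2
        omega
      · rw [show t ^ 2 / 8 * n = t ^ 2 * n / 8 by ring, ht2]
        ring_nf
    · rw [Fintype.card_prod, Fintype.card_fin, Fintype.card_fin, Nat.cast_mul,
        Nat.cast_sub (by omega), Nat.cast_one]
  have hB3 : P.real B3 ≤ (Nτ * N) * (Nτ * N) * (4 * ((Nτ * N : ℝ) ^ 4)⁻¹) := by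
    rw [← hexp4]
    refine (measureReal_exists_le (ε := 4 * Real.exp (-(4 * L))) fun c => ?_).trans ?_
    · by_cases h0 : ∑ i, conj (aT c.1.2 i) * aT c.2.2 i = 0
      · simp only [h0, true_and]
        refine (measureReal_le_norm_crosscorrelation hy (hT c.1.2) (hT c.2.2) h0 _ ht0
          ht3).trans (le_of_eq ?_)
        rw [show t ^ 2 / 4 * n = t ^ 2 * n / 4 by ring, ht2]
        ring_nf
      · simp only [h0, false_and]
        simp only [Set.ofPred_false, measureReal_empty]
        positivity
    · simp
  refine le_trans ?_ (one_sub_measureReal_le (B := B1 ∪ (B2 ∪ B3)) fun ω hω => ?_)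
  · have h1 := measureReal_union_le (μ := P) B1 (B2 ∪ B3)
    have h2 := measureReal_union_le (μ := P) B2 B3
    have h3 : N * ((Nτ * N : ℝ) ^ 2)⁻¹ + (N * (Nτ - 1) * (4 * ((Nτ * N : ℝ) ^ 2)⁻¹)
        + (Nτ * N) * (Nτ * N) * (4 * ((Nτ * N : ℝ) ^ 4)⁻¹)) ≤ 2 * (N : ℝ)⁻¹ := by
      have h4 : N * ((Nτ * N : ℝ) ^ 2)⁻¹ + (N * (Nτ - 1) * (4 * ((Nτ * N : ℝ) ^ 2)⁻¹)
          + (Nτ * N) * (Nτ * N) * (4 * ((Nτ * N : ℝ) ^ 4)⁻¹))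
          = (N + 4 * N * (Nτ - 1) + 4) / (Nτ * N) ^ 2 := by
        field_simp
        ring
      rw [h4, div_le_iff₀ (by positivity), show 2 * (N : ℝ)⁻¹ * (Nτ * N) ^ 2 = 2 * N * Nτ ^ 2 by
        field_simp]
      have h5 : 1 ≤ ((Nτ : ℝ) - 1) ^ 2 := by nlinarith
      nlinarith
    linarith
  · simp only [B1, B2, B3, Set.mem_union, Set.mem_ofPred_eq, not_or, not_exists, not_le, not_and,
      Prod.forall] at hω
    refine (coherence_normalizeColumns_le_of_correlation_le hR hφ hψ h (hM ω) ht0.le hω.1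
      (fun b k => hω.2.1 b k) (fun p q => hω.2.2 p.1 p.2 q.1 q.2)).trans (le_of_eq ?_)
    rw [ht]
    ring

end Response

end MIMORadar

end

theorem mainTheorem5 :
    ∃ C : ℝ, 0 < C ∧
      ∀ (Ω : Type*) [MeasurableSpace Ω] (P : Measure Ω) [IsProbabilityMeasure P]
        (NT NR Nt Nτ : ℕ) (B T Δt Δτ Δβ dT dR : ℝ) (s : Fin NT → ℝ → Ω → ℂ)
        (Atilde : Ω → Matrix (Fin NR × Fin Nt) (Fin Nτ × Fin (NR * NT)) ℂ),
        1 ≤ NT → 1 ≤ NR → 0 < B →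
        Δt = 1 / (2 * B) → (Nt : ℝ) = T / Δt →
        Δτ = 1 / (2 * B) → Δβ = 2 / ((NR : ℝ) * (NT : ℝ)) →
        ((dT = 1 / 2 ∧ dR = (NT : ℝ) / 2) ∨ (dT = (NR : ℝ) / 2 ∧ dR = 1 / 2)) →
        128 ≤ Nt → Nτ ≤ Nt →
        Real.sqrt ((NR : ℝ) * (NT : ℝ)) ≤ (Nτ : ℝ) →
        Real.log ((Nτ : ℝ) * ((NR : ℝ) * (NT : ℝ))) ^ 3 ≤ (Nt : ℝ) →
        MIMORadar.IsPeriodicWhiteNoise P Nt T Δt (1 / (NT : ℝ≥0)) s →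
        (∀ ω, Atilde ω = MIMORadar.normalizeColumns
          (MIMORadar.responseMatrix NR Nt Nτ (NR * NT) dT dR Δt Δτ Δβ
            (fun i t => s i t ω))) →
        1 - (Real.exp (-((Nt : ℝ) * (Real.sqrt (1 / 3) - 1) ^ 2 / 2))
              + (Nt : ℝ) ^ (1 - C * Real.sqrt (NT : ℝ)))
            ≤ P.real {ω | MIMORadar.opNorm (Atilde ω) ^ 2
                < 3 * (NT : ℝ) * (1 + Real.log (Nt : ℝ))} ∧
        1 - (2 * Real.exp (-((Nt : ℝ) * (Real.sqrt 2 - 1) ^ 2 / 4))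
              + 2 * ((NR : ℝ) * (NT : ℝ))⁻¹
              + 6 * ((Nt : ℝ) * (NR : ℝ) * (NT : ℝ))⁻¹)
            ≤ P.real {ω | MIMORadar.coherence (Atilde ω)
                ≤ 6 * Real.sqrt (1 / (Nt : ℝ)
                    * Real.log ((Nτ : ℝ) * (NR : ℝ) * (NT : ℝ)))} := by

  -- The value `1/2` is the exponent gained in `mul_pow_exp_neg_log_le`.
  refine ⟨1 / 2, by norm_num, ?_⟩
  intro Ω _ P _ NT NR Nt Nτ B T Δt Δτ Δβ dT dR s Atilde hNT hNR hB hΔt hT hΔτ hΔβ hd hNt hτ hNτ _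
    hs hA
  have hΔt0 : 0 < Δt := by rw [hΔt]; positivity
  obtain rfl : T = Nt * Δt := by rw [hT]; field_simp
  obtain rfl : Δτ = Δt := by rw [hΔτ, hΔt]
  subst hΔβ
  have : NeZero Nt := ⟨by omega⟩
  have : NeZero NT := ⟨by omega⟩
  have : NeZero NR := ⟨by omega⟩
  have : NeZero (NR * NT) := ⟨Nat.mul_ne_zero (by omega) (by omega)⟩
  have hN : NR * NT ≤ Nτ ^ 2 := by
    have := (Real.sqrt_le_left (Nat.cast_nonneg Nτ)).1 hNτ
    exact_mod_cast this
  obtain ⟨ψ, hψ, h⟩ := MIMORadar.arrayManifold_mul_arrayManifold hd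
  have hM : ∀ ω k l p, _ = _ := fun ω => MIMORadar.responseMatrix_apply (NR := NR) (Nτ := Nτ)
    (Nβ := NR * NT) (dT := dT) (dR := dR) (Δβ := 2 / ((NR : ℝ) * NT))
    (s := fun i t => s i t ω) (fun i => hs.periodic i ω)
  have hφ := MIMORadar.bijective_fin_succ (NR * NT)
  simp_rw [hA]
  constructor
  · exact MIMORadar.one_sub_le_measureReal_opNorm hs.hasLaw_cyclicSamples
      (fun _ _ => MIMORadar.norm_arrayManifold _ _ _ _)
      (fun _ _ => MIMORadar.norm_arrayManifold _ _ _ _) hφ hψ (fun b => h b) hM rfl hNt hτ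
      (hN.trans (Nat.pow_le_pow_left hτ 2))
  · have h1 := MIMORadar.one_sub_le_measureReal_coherence hs.hasLaw_cyclicSamples
      (fun _ _ => MIMORadar.norm_arrayManifold _ _ _ _)
      (fun _ _ => MIMORadar.norm_arrayManifold _ _ _ _) hφ hψ (fun b => h b) hM hτ hN
    rw [Nat.cast_mul, ← mul_assoc] at h1
    refine le_trans ?_ h1
    -- The term `2 / (NR NT)` alone bounds the failure probability; the other two summands are only
    -- nonnegative slack.
    have h2 : 0 ≤ 2 * Real.exp (-((Nt : ℝ) * (Real.sqrt 2 - 1) ^ 2 / 4)) := by positivity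
    have h3 : 0 ≤ 6 * ((Nt : ℝ) * (NR : ℝ) * (NT : ℝ))⁻¹ := by positivity
    linarith
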